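/- Let $N$ be a finite set of individuals and let $\varphi : N\times N\to\{0,1\}$ be a profile, where $\varphi(a,b)=1$ means that $a$ qualifies $b$. For $T\subseteq N$ put $K_0(\varphi,T)=\{a\in T : \varphi(b,a)=1 \text{ for all } b\in T\}$ and $K_\ell(\varphi,T)=K_{\ell-1}(\varphi,T)\cup\{a\in T : \varphi(b,a)=1 \text{ for some } b\in K_{\ell-1}(\varphi,T)\}$ for $\ell\ge 1$. The consensus-start-respecting rule $f^{\mathrm{CSR}}$ assigns to $(\varphi,T)$ the set $f^{\mathrm{CSR}}(\varphi,T)$ at which the increasing sequence $K_0(\varphi,T)\subseteq K_1(\varphi,T)\subseteq\cdots$ becomes stationary. The profile $\varphi$ is qualifying consecutive (QC) if there is a linear order on $N$ such that for every $a\in N$ the set $\{b\in N:\varphi(a,b)=1\}$ is a (possibly empty) set of consecutive elements in this order. Group Control by Adding Individuals (GCAI) for $f^{\mathrm{CSR}}$ is the following decision problem. Given $N$, a profile $\varphi$ over $N$, nonempty sets $S\subseteq T\subseteq N$ and an integer $k$, is there a set $U\subseteq N\setminus T$ with $|U|\le k$ and $S\subseteq f^{\mathrm{CSR}}(\varphi,T\cup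 U)$? **Theorem.** GCAI for $f^{\mathrm{CSR}}$ is solvable in polynomial time when restricted to QC profiles. That is, there are an algorithm and a polynomial $b$ such that on every instance $(N,\varphi,S,T,k)$ of GCAI in which $\varphi$ is QC (a witnessing linear order is not part of the input), the algorithm halts after at most $b(L)$ steps with the correct answer, where $L$ is the length of the binary encoding of the instance ($\varphi$, $S$ and $T$ are given by their tables of values and $k$ in binary). -/

import Mathlib

/-! ## Group identification -/

namespace GroupIdent

/-- A profile over `N`: `φ a b = true` means that `a` qualifies `b`, and `φ a b = false` that `a`
disqualifies `b`. -/
abbrev Profile (N : Type*) : Type _ := N → N → Bool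

/-- The sets `K_ℓ` of the consensus-start-respecting rule. `K_0` consists of the members of `T`
qualified by all members of `T`; `K_{ℓ+1}` adds to `K_ℓ` all members of `T` qualified by at least
one member of `K_ℓ`. -/
def consensusStage {N : Type*} [DecidableEq N] (φ : Profile N) (T : Finset N) : ℕ → Finset N
  | 0 => T.filter fun a => ∀ b ∈ T, φ b a = true
  | l + 1 => consensusStage φ T l ∪
      T.filter fun a => ∃ b ∈ consensusStage φ T l, φ b a = true

/-- The set of socially qualified individuals in `T` under the consensus-start-respecting rule:
the set at which the increasing sequence `K_0 ⊆ K_1 ⊆ ⋯` becomes stationary, that is, its union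
(see `exists_consensusStage_stable` and `csr_eq_of_stable`). -/
def csr {N : Type*} [DecidableEq N] (φ : Profile N) (T : Finset N) : Set N :=
  {a | ∃ l, a ∈ consensusStage φ T l}

theorem consensusStage_subset {N : Type*} [DecidableEq N] (φ : Profile N) (T : Finset N) (l : ℕ) :
    consensusStage φ T l ⊆ T := by
  induction l with
  | zero => exact Finset.filter_subset _ _
  | succ l ih => exact Finset.union_subset ih (Finset.filter_subset _ _)

theorem consensusStage_mono {N : Type*} [DecidableEq N] (φ : Profile N) (T : Finset N) :
    Monotone (consensusStage φ T) :=
  monotone_nat_of_le_succ fun _ => Finset.subset_union_left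

/-- The sequence `K_ℓ` becomes stationary. -/
theorem exists_consensusStage_stable {N : Type*} [DecidableEq N] (φ : Profile N) (T : Finset N) :
    ∃ l, consensusStage φ T (l + 1) = consensusStage φ T l := by
  by_contra h
  have hlt : ∀ l, l ≤ (consensusStage φ T l).card := by
    intro l
    induction l with
    | zero => exact Nat.zero_le _
    | succ l ih =>
      have hss : consensusStage φ T l ⊂ consensusStage φ T (l + 1) :=
        lt_of_le_of_ne (consensusStage_mono φ T (Nat.le_succ l)) fun e => h ⟨l, e.symm⟩
      exact Nat.succ_le_of_lt (lt_of_le_of_lt ih (Finset.card_lt_card hss))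
  have h1 := hlt (T.card + 1)
  have h2 := Finset.card_le_card (consensusStage_subset φ T (T.card + 1))
  omega

/-- Whenever `K_{ℓ+1} = K_ℓ`, this set is the value of the rule. -/
theorem csr_eq_of_stable {N : Type*} [DecidableEq N] (φ : Profile N) (T : Finset N) (l : ℕ)
    (h : consensusStage φ T (l + 1) = consensusStage φ T l) :
    csr φ T = (consensusStage φ T (l + 1) : Set N) := by
  have key : ∀ m, consensusStage φ T (l + m) = consensusStage φ T l := by
    intro m
    induction m with
    | zero => rfl
    | succ m ih =>
      have e : consensusStage φ T (l + m + 1) = consensusStage φ T (l + 1) := by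
        simp only [consensusStage, ih]
      exact e.trans h
  ext a
  constructor
  · rintro ⟨m, hm⟩
    have h1 : a ∈ consensusStage φ T (l + m) := consensusStage_mono φ T (Nat.le_add_left m l) hm
    rw [key m, ← h] at h1
    exact h1
  · intro ha
    exact ⟨l + 1, ha⟩

/-- `φ` is qualifying consecutive with respect to the linear order in which the individuals are
`ord 0, ord 1, …`: for every individual `a`, the positions of the individuals whom `a` qualifies
form an interval (which is empty if `j < i`). -/
def IsQCWith {N : Type*} [Fintype N] (φ : Profile N) (ord : Fin (Fintype.card N) ≃ N) : Prop :=
  ∀ a : N, ∃ i j : ℕ, ∀ x : Fin (Fintype.card N),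
    φ a (ord x) = true ↔ i ≤ (x : ℕ) ∧ (x : ℕ) ≤ j

/-- `φ` is qualifying consecutive (QC): it is so with respect to some linear order. -/
def IsQC {N : Type*} [Fintype N] (φ : Profile N) : Prop :=
  ∃ ord : Fin (Fintype.card N) ≃ N, IsQCWith φ ord

/-- An instance of Group Control by Adding Individuals, with individuals numbered
`0, …, n - 1`. -/
structure GCAIInstance where
  n : ℕ
  φ : Profile (Fin n)
  S : Finset (Fin n)
  T : Finset (Fin n)
  k : ℤ
  S_nonempty : S.Nonempty
  S_subset_T : S ⊆ T

/-- The yes-instances of Group Control by Adding Individuals for the consensus-start-respecting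
rule. -/
def GCAIInstance.IsYesCSR (I : GCAIInstance) : Prop :=
  ∃ U : Finset (Fin I.n), Disjoint U I.T ∧ (U.card : ℤ) ≤ I.k ∧
    (I.S : Set (Fin I.n)) ⊆ csr I.φ (I.T ∪ U)

/-- The bit string by which an instance is presented to an algorithm: `n` ones and a zero, the
characteristic vectors of `S` and of `T`, the matrix of `φ` row by row, the sign of `k`, and the
binary digits of `|k|` (least significant first). -/
def GCAIInstance.encode (I : GCAIInstance) : List Bool :=
  List.replicate I.n true ++ [false] ++
  (List.finRange I.n).map (fun a => decide (a ∈ I.S)) ++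
  (List.finRange I.n).map (fun a => decide (a ∈ I.T)) ++
  (List.finRange I.n).flatMap (fun a => (List.finRange I.n).map fun b => I.φ a b) ++
  [decide (I.k < 0)] ++ Nat.bits I.k.natAbs

end GroupIdent

/-! ## Random access machines

A random access machine with memory cells indexed by the natural numbers, each holding a natural
number, with indirect addressing, addition and truncated subtraction, and with structured control
flow. Every elementary operation costs one step. As there is no multiplication, polynomial time on
this machine is polynomial time on Turing machines. -/

namespace RAM

/-- The contents of the memory. -/
abbrev Mem : Type := ℕ → ℕ

inductive Expr : Type
  /-- a constant -/
  | lit (c : ℕ)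
  /-- the content of the cell whose address is the value of `e` -/
  | read (e : Expr)
  | add (e f : Expr)
  /-- subtraction, truncated at `0` -/
  | sub (e f : Expr)

def Expr.eval (m : Mem) : Expr → ℕ
  | .lit c => c
  | .read e => m (e.eval m)
  | .add e f => e.eval m + f.eval m
  | .sub e f => e.eval m - f.eval m

/-- The number of operations in an evaluation of the expression. -/
def Expr.cost : Expr → ℕ
  | .lit _ => 1
  | .read e => e.cost + 1
  | .add e f => e.cost + f.cost + 1
  | .sub e f => e.cost + f.cost + 1

inductive Prog : Type
  | skip
  /-- write the value of `val` into the cell whose address is the value of `addr` -/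
  | store (addr val : Expr)
  | seq (p q : Prog)
  /-- run `p` if the value of `e` is not `0`, and `q` otherwise -/
  | cond (e : Expr) (p q : Prog)
  /-- run `p` as long as the value of `e` is not `0` -/
  | loop (e : Expr) (p : Prog)

/-- `Runs p m t m'`: started on the memory `m`, the program `p` halts after exactly `t` steps and
leaves the memory `m'`. -/
inductive Runs : Prog → Mem → ℕ → Mem → Prop
  | skip (m : Mem) : Runs .skip m 1 m
  | store (addr val : Expr) (m : Mem) :
      Runs (.store addr val) m (addr.cost + val.cost + 1)
        (Function.update m (addr.eval m) (val.eval m))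
  | seq {p q : Prog} {m m' m'' : Mem} {s t : ℕ} :
      Runs p m s m' → Runs q m' t m'' → Runs (.seq p q) m (s + t) m''
  | cond_true {e : Expr} {p q : Prog} {m m' : Mem} {t : ℕ} :
      e.eval m ≠ 0 → Runs p m t m' → Runs (.cond e p q) m (e.cost + 1 + t) m'
  | cond_false {e : Expr} {p q : Prog} {m m' : Mem} {t : ℕ} :
      e.eval m = 0 → Runs q m t m' → Runs (.cond e p q) m (e.cost + 1 + t) m'
  | loop_done {e : Expr} {p : Prog} {m : Mem} :
      e.eval m = 0 → Runs (.loop e p) m (e.cost + 1) m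
  | loop_step {e : Expr} {p : Prog} {m m' m'' : Mem} {s t : ℕ} :
      e.eval m ≠ 0 → Runs p m s m' → Runs (.loop e p) m' t m'' →
        Runs (.loop e p) m (e.cost + 1 + s + t) m''

/-- Programs are deterministic: running time and final memory are unique. -/
theorem Runs.unique {p : Prog} {m m₁ m₂ : Mem} {t₁ t₂ : ℕ} (h₁ : Runs p m t₁ m₁)
    (h₂ : Runs p m t₂ m₂) : t₁ = t₂ ∧ m₁ = m₂ := by
  induction h₁ generalizing t₂ m₂ with
  | skip m => cases h₂; exact ⟨rfl, rfl⟩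
  | store addr val m => cases h₂; exact ⟨rfl, rfl⟩
  | seq _ _ ih₁ ih₂ =>
    cases h₂ with
    | seq a b =>
      obtain ⟨rfl, rfl⟩ := ih₁ a
      obtain ⟨rfl, rfl⟩ := ih₂ b
      exact ⟨rfl, rfl⟩
  | cond_true h _ ih =>
    cases h₂ with
    | cond_true _ a => obtain ⟨rfl, rfl⟩ := ih a; exact ⟨rfl, rfl⟩
    | cond_false h' _ => exact absurd h' h
  | cond_false h _ ih =>
    cases h₂ with
    | cond_true h' _ => exact absurd h h'
    | cond_false _ a => obtain ⟨rfl, rfl⟩ := ih a; exact ⟨rfl, rfl⟩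
  | loop_done h =>
    cases h₂ with
    | loop_done _ => exact ⟨rfl, rfl⟩
    | loop_step h' _ _ => exact absurd h h'
  | loop_step h _ _ ih₁ ih₂ =>
    cases h₂ with
    | loop_done h' => exact absurd h' h
    | loop_step _ a b =>
      obtain ⟨rfl, rfl⟩ := ih₁ a
      obtain ⟨rfl, rfl⟩ := ih₂ b
      exact ⟨rfl, rfl⟩

/-- The initial memory on the input `w`: cell `0` holds the length of `w`, cell `i + 1` the `i`-th
bit of `w` for `i < w.length`, and all other cells hold `0`. -/
def initMem (w : List Bool) : Mem
  | 0 => w.length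
  | i + 1 => (w.getD i false).toNat

/-- The decision problem "is `yes x` true?", restricted to the inputs `x` with `dom x`, is solvable
in polynomial time, where `x` is presented as the bit string `encode x`: one fixed program halts on
each such input within a number of steps that is polynomial in the length of the bit string, and
leaves in cell `0` the answer, `1` for yes and `0` for no. -/
def PolyTimeSolvableOn {α : Type*} (encode : α → List Bool) (dom yes : α → Prop) : Prop :=
  ∃ (p : Prog) (b : Polynomial ℕ), ∀ x : α, dom x →
    ∃ (t : ℕ) (m : Mem), Runs p (initMem (encode x)) t m ∧ t ≤ b.eval (encode x).length ∧
      (yes x → m 0 = 1) ∧ (¬ yes x → m 0 = 0)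

end RAM

/-! Suppose adding `U` makes the nonempty set `S` socially qualified, and put `W = T ∪ U`. Then the
consensus start `K_0` of `W` contains some `c`. All members of `W` qualify `c`, so in a QC order
their qualification sets are intervals through the position of `c`. Of three such intervals one lies
in the union of the other two (`IsQC.exists_covered`). Hence what a growing set of individuals
jointly qualifies is always described by two of its members, one reaching furthest to each side.
Running the rule from `c` becomes a walk on pairs that starts at `(c, c)` and replaces one member at
a time by an individual already qualified (`PairReach`), at price 1 for each individual outside `T`.

A walk to a pair that jointly qualifies `S` yields a solution: add the visited individuals
(`PairReach.exists_visited`, `exists_control_of_pairReach`). This direction holds for every profile.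
Conversely, a largest set that can be explored inside `W` while being covered by its current pair
leaves nothing further to discover, so its pair qualifies all of `S` (`IsQC.exists_pairReach`). The
order occurs only in this argument; the algorithm never has to find one.

The algorithm tabulates reachability by step number, price, `c`, `a` and `b`. All five may be taken
below the input length `L`, so there are `L ^ 5` truth values, each computed from those with a
smaller step number.

To bound the running time, the algorithm is written in a small language in which every loop is
bounded by `L`. Structural induction gives each compiled program a polynomial bound
(`BExpr.correct`, `Cmd.correct`). What remains is to verify the table (`GCAIInstance.exec_reachCmd`)
and the final search in it (`GCAIInstance.truthy_answerExpr`). -/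

namespace GroupIdent

/-- Among three individuals who qualify `c`, one qualifies nobody but those qualified by the other
two. -/
theorem IsQC.exists_covered {N : Type*} [Fintype N] {φ : Profile N} (h : IsQC φ) {c u v w : N}
    (hu : φ u c = true) (hv : φ v c = true) (hw : φ w c = true) :
    (∀ y, φ w y = true → φ u y = true ∨ φ v y = true) ∨
    (∀ y, φ u y = true → φ w y = true ∨ φ v y = true) ∨
    (∀ y, φ v y = true → φ u y = true ∨ φ w y = true) := by
  obtain ⟨ord, ho⟩ := h
  have key : ∀ a, ∃ i j : ℕ, ∀ y, φ a y = true ↔ i ≤ (ord.symm y : ℕ) ∧ (ord.symm y : ℕ) ≤ j := by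
    intro a
    obtain ⟨i, j, hij⟩ := ho a
    exact ⟨i, j, fun y => by simpa using hij (ord.symm y)⟩
  obtain ⟨i₁, j₁, h₁⟩ := key u
  obtain ⟨i₂, j₂, h₂⟩ := key v
  obtain ⟨i₃, j₃, h₃⟩ := key w
  rw [h₁] at hu
  rw [h₂] at hv
  rw [h₃] at hw
  simp only [h₁, h₂, h₃]
  -- An interval that is extreme on neither side lies in the union of the other two, which has no
  -- gap since both contain `c`. If this fails for `w` and for `u`, each is strictly extreme on some
  -- side, and on different sides, so `v` lies between them.
  by_cases hA : (i₁ ≤ i₃ ∨ i₂ ≤ i₃) ∧ (j₃ ≤ j₁ ∨ j₃ ≤ j₂)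
  · exact Or.inl fun y hy => by omega
  by_cases hB : (i₃ ≤ i₁ ∨ i₂ ≤ i₁) ∧ (j₁ ≤ j₃ ∨ j₁ ≤ j₂)
  · exact Or.inr (Or.inl fun y hy => by omega)
  · exact Or.inr (Or.inr fun y hy => by omega)

/-! ### Reachability of pairs and its equivalence with control -/

section Reach

variable {N : Type*} [DecidableEq N]

/-- The price of using an individual: `1` outside of `T`, and `0` in `T`. -/
def price (T : Finset N) (a : N) : ℕ := if a ∈ T then 0 else 1

/-- The pair `(a, b)` can be obtained from `(c, c)` in at most `t` steps at the total price `x`,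
where a step replaces a member of the pair by an individual that qualifies `c` and is qualified by
a member of the pair. -/
def PairReach (φ : Profile N) (T : Finset N) (c : N) : ℕ → ℕ → N → N → Prop
  | 0, x, a, b => a = c ∧ b = c ∧ x = price T c
  | t + 1, x, a, b => PairReach φ T c t x a b ∨
      (φ a c = true ∧ price T a ≤ x ∧
        ∃ a', (φ a' a = true ∨ φ b a = true) ∧ PairReach φ T c t (x - price T a) a' b) ∨
      (φ b c = true ∧ price T b ≤ x ∧
        ∃ b', (φ a b = true ∨ φ b' b = true) ∧ PairReach φ T c t (x - price T b) a b')

theorem PairReach.mono {φ : Profile N} {T : Finset N} {c : N} {s t x : ℕ} {a b : N} (hst : s ≤ t)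
    (h : PairReach φ T c s x a b) : PairReach φ T c t x a b := by
  induction hst with
  | refl => exact h
  | step _ ih => exact Or.inl ih

theorem mem_csr_of_qualified {φ : Profile N} {W : Finset N} {a b : N} (hb : b ∈ csr φ W)
    (ha : a ∈ W) (h : φ b a = true) : a ∈ csr φ W := by
  obtain ⟨l, hl⟩ := hb
  refine ⟨l + 1, Finset.mem_union_right _ (Finset.mem_filter.2 ⟨ha, b, hl, h⟩)⟩

theorem mem_consensusStage_zero {φ : Profile N} {W : Finset N} {c : N} :
    c ∈ consensusStage φ W 0 ↔ c ∈ W ∧ ∀ b ∈ W, φ b c = true :=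
  Finset.mem_filter

theorem mem_csr_of_consensus {φ : Profile N} {W : Finset N} {c : N} (hc : c ∈ W)
    (h : ∀ b ∈ W, φ b c = true) : c ∈ csr φ W :=
  ⟨0, mem_consensusStage_zero.2 ⟨hc, h⟩⟩

/-- The individuals used to reach a pair are socially qualified once they are added. -/
theorem PairReach.exists_visited {φ : Profile N} {T : Finset N} {c : N} (hcc : φ c c = true)
    {t x : ℕ} {a b : N} (h : PairReach φ T c t x a b) :
    ∃ V : Finset N, c ∈ V ∧ a ∈ V ∧ b ∈ V ∧ (∀ v ∈ V, φ v c = true) ∧ (V \ T).card ≤ x ∧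
      ∀ W, V ⊆ W → (∀ v ∈ W, φ v c = true) → ∀ v ∈ V, v ∈ csr φ W := by
  -- Bookkeeping for one step of the walk. The set may already contain `q`, in which case the walk
  -- pays twice; hence only an upper bound on the number of added individuals.
  have extend : ∀ {V : Finset N} {y : ℕ} {p q : N}, c ∈ V → p ∈ V →
      (∀ v ∈ V, φ v c = true) → (V \ T).card ≤ y →
      (∀ W, V ⊆ W → (∀ v ∈ W, φ v c = true) → ∀ v ∈ V, v ∈ csr φ W) →
      φ p q = true → φ q c = true →
      (∀ v ∈ insert q V, φ v c = true) ∧ (insert q V \ T).card ≤ y + price T q ∧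
      ∀ W, insert q V ⊆ W → (∀ v ∈ W, φ v c = true) → ∀ v ∈ insert q V, v ∈ csr φ W := by
    intro V y p q hc hp hV hy hW hpq hq
    refine ⟨?_, ?_, ?_⟩
    · intro v hv
      rcases Finset.mem_insert.1 hv with rfl | hv
      · exact hq
      · exact hV v hv
    · unfold price
      split_ifs with hT
      · rw [Finset.insert_sdiff_of_mem _ hT]
        exact hy
      · rw [Finset.insert_sdiff_of_notMem _ hT]
        exact (Finset.card_insert_le _ _).trans (by omega)
    · intro W hVW hWc v hv
      have hsub : V ⊆ W := (Finset.subset_insert q V).trans hVW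
      rcases Finset.mem_insert.1 hv with rfl | hv
      · exact mem_csr_of_qualified (hW W hsub hWc p hp) (hVW (Finset.mem_insert_self _ _)) hpq
      · exact hW W hsub hWc v hv
  induction t generalizing x a b with
  | zero =>
    obtain ⟨rfl, rfl, rfl⟩ := h
    refine ⟨{b}, by simp, by simp, by simp, by simpa using hcc, ?_, ?_⟩
    · unfold price
      split_ifs with hT
      · simp [hT]
      · exact (Finset.card_le_card Finset.sdiff_subset).trans (by simp)
    · intro W hVW hW v hv
      obtain rfl := Finset.mem_singleton.1 hv
      exact mem_csr_of_consensus (hVW hv) hW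
  | succ t ih =>
    rcases h with h | ⟨hac, hx, a', hq, h⟩ | ⟨hbc, hx, b', hq, h⟩
    · exact ih h
    · obtain ⟨V, hc, ha, hb, hV, hy, hW⟩ := ih h
      obtain ⟨p, hp, hpa⟩ : ∃ p ∈ V, φ p a = true := by
        rcases hq with hq | hq
        exacts [⟨_, ha, hq⟩, ⟨_, hb, hq⟩]
      obtain ⟨h1, h2, h3⟩ := extend hc hp hV hy hW hpa hac
      exact ⟨insert a V, Finset.mem_insert_of_mem hc, Finset.mem_insert_self _ _,
        Finset.mem_insert_of_mem hb, h1, by omega, h3⟩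
    · obtain ⟨V, hc, ha, hb, hV, hy, hW⟩ := ih h
      obtain ⟨p, hp, hpb⟩ : ∃ p ∈ V, φ p b = true := by
        rcases hq with hq | hq
        exacts [⟨_, ha, hq⟩, ⟨_, hb, hq⟩]
      obtain ⟨h1, h2, h3⟩ := extend hc hp hV hy hW hpb hbc
      exact ⟨insert b V, Finset.mem_insert_of_mem hc, Finset.mem_insert_of_mem ha,
        Finset.mem_insert_self _ _, h1, by omega, h3⟩

/-- If a pair that jointly qualifies all of `S` can be reached at the price `x`, then `x` added
individuals suffice. -/
theorem exists_control_of_pairReach {φ : Profile N} {S T : Finset N} (hST : S ⊆ T) {c : N}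
    (hcc : φ c c = true) (hT : ∀ b ∈ T, φ b c = true) {t x : ℕ} {a b : N}
    (h : PairReach φ T c t x a b) (hS : ∀ s ∈ S, φ a s = true ∨ φ b s = true) :
    ∃ U : Finset N, Disjoint U T ∧ U.card ≤ x ∧ (S : Set N) ⊆ csr φ (T ∪ U) := by
  obtain ⟨V, hc, ha, hb, hV, hy, hW⟩ := h.exists_visited hcc
  -- Everybody in `T ∪ V` qualifies `c`, so `c` belongs to the consensus start there and the visited
  -- individuals follow.
  refine ⟨V \ T, Finset.sdiff_disjoint, hy, fun s hs => ?_⟩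
  rw [Finset.union_sdiff_self_eq_union]
  have hW' := hW (T ∪ V) Finset.subset_union_right fun v hv =>
    (Finset.mem_union.1 hv).elim (hT v) (hV v)
  have hsW : s ∈ T ∪ V := Finset.mem_union_left _ (hST hs)
  rcases hS s hs with h | h
  · exact mem_csr_of_qualified (hW' a ha) hsW h
  · exact mem_csr_of_qualified (hW' b hb) hsW h

/-- Induction on the stages: members of `K_0` are qualified by everybody in `W`, in particular by
`a`, and closedness passes the property on to whomever they qualify. -/
theorem csr_subset_of_closed {φ : Profile N} {W : Finset N} {a b : N} (ha : a ∈ W)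
    (h : ∀ w ∈ W, φ a w = true ∨ φ b w = true → ∀ y, φ w y = true → φ a y = true ∨ φ b y = true)
    {s : N} (hs : s ∈ csr φ W) : φ a s = true ∨ φ b s = true := by
  obtain ⟨l, hl⟩ := hs
  induction l generalizing s with
  | zero => exact Or.inl ((mem_consensusStage_zero.1 hl).2 a ha)
  | succ l ih =>
    rcases Finset.mem_union.1 hl with hl | hl
    · exact ih hl
    · obtain ⟨-, w, hw, hws⟩ := Finset.mem_filter.1 hl
      exact h w (consensusStage_subset φ W l hw) (ih hw) s hws

/-- If adding `U` makes all of `S` socially qualified, then a pair that jointly qualifies all of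
`S` can be reached at a price of at most `|U|`. -/
theorem IsQC.exists_pairReach [Fintype N] {φ : Profile N} (hQC : IsQC φ) {S T U : Finset N}
    (hS : S.Nonempty) (hU : (S : Set N) ⊆ csr φ (T ∪ U)) :
    ∃ c x a b, x ≤ U.card ∧ φ c c = true ∧ (∀ t ∈ T, φ t c = true) ∧
      PairReach φ T c (Fintype.card N) x a b ∧ ∀ s ∈ S, φ a s = true ∨ φ b s = true := by
  obtain ⟨s₀, hs₀⟩ := hS
  -- If `K_0` were empty, so would be every later stage, but `S` is not.
  have hne : ∃ c, c ∈ consensusStage φ (T ∪ U) 0 := by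
    by_contra! hno
    have : ∀ l y, y ∉ consensusStage φ (T ∪ U) l := by
      intro l
      induction l with
      | zero => exact hno
      | succ l ih =>
        intro y hy
        rcases Finset.mem_union.1 hy with hy | hy
        · exact ih y hy
        · obtain ⟨-, w, hw, -⟩ := Finset.mem_filter.1 hy
          exact ih w hw
    obtain ⟨l, hl⟩ := hU hs₀
    exact this l s₀ hl
  obtain ⟨c, hc⟩ := hne
  obtain ⟨hcW, hWc⟩ := mem_consensusStage_zero.1 hc
  set W := T ∪ U with hW
  -- `P` is the set explored so far, and the pair in it qualifies everything that `P` does. The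
  -- requirement `t + 1 ≤ r` keeps the number of steps below the number of individuals, and each
  -- member of `P` outside `T` is paid for exactly once.
  let good : ℕ → Prop := fun r => ∃ (t : ℕ) (P : Finset N) (a b : N), P.card = r ∧ t + 1 ≤ r ∧
    P ⊆ W ∧ a ∈ P ∧ b ∈ P ∧ (∀ p ∈ P, ∀ y, φ p y = true → φ a y = true ∨ φ b y = true) ∧
    PairReach φ T c t (P \ T).card a b
  have hgood : good 1 := by
    refine ⟨0, {c}, c, c, by simp, le_rfl, by simpa using hcW, by simp, by simp, by simp, rfl, rfl,
      ?_⟩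
    unfold price
    split_ifs with hT
    · simp [hT]
    · rw [Finset.sdiff_eq_self_of_disjoint (by simpa using hT)]
      simp
  have hbound : ∀ r, good r → r ≤ Fintype.card N := by
    rintro r ⟨t, P, a, b, rfl, -⟩
    exact Finset.card_le_univ P
  classical
  obtain ⟨t, P, a, b, hcard, ht, hPW, ha, hb, hcov, hreach⟩ :=
    Nat.findGreatest_spec (hbound 1 hgood) hgood
  have hmax : ∀ r, good r → r ≤ P.card := fun r hr => by
    rw [hcard]
    exact Nat.le_findGreatest (hbound r hr) hr
  refine ⟨c, (P \ T).card, a, b, ?_, hWc c hcW, fun t ht => hWc t (Finset.mem_union_left _ ht),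
    hreach.mono (by have := Finset.card_le_univ P; omega), fun s hs => ?_⟩
  · refine Finset.card_le_card fun p hp => ?_
    obtain ⟨hp, hpT⟩ := Finset.mem_sdiff.1 hp
    exact (Finset.mem_union.1 (hPW hp)).resolve_left hpT
  · refine csr_subset_of_closed (hPW ha) (fun w hw hq => ?_) (hU hs)
    by_contra hncov
    have hwP : w ∉ P := fun hwP => hncov (hcov w hwP)
    have hsub : insert w P ⊆ W := Finset.insert_subset hw hPW
    have hcard' : (insert w P \ T).card = (P \ T).card + price T w := by
      unfold price
      split_ifs with hT
      · rw [Finset.insert_sdiff_of_mem _ hT, add_zero]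
      · rw [Finset.insert_sdiff_of_notMem _ hT, Finset.card_insert_of_notMem (by simp [hwP])]
    have hlarger : good (P.card + 1) := by
      -- An uncovered `w` within reach makes `a` or `b` redundant. Replacing that one by `w`
      -- explores a larger set, against maximality.
      rcases hQC.exists_covered (hWc a (hPW ha)) (hWc b (hPW hb)) (hWc w hw) with h | h | h
      · exact absurd h hncov
      · refine ⟨t + 1, insert w P, w, b, Finset.card_insert_of_notMem hwP, by omega, hsub,
          by simp, by simp [hb], ?_, Or.inr (Or.inl ⟨hWc w hw, by omega, a, hq, ?_⟩)⟩
        · intro p hp y hy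
          rcases Finset.mem_insert.1 hp with rfl | hp
          · exact Or.inl hy
          · exact (hcov p hp y hy).elim (h y) Or.inr
        · rw [hcard', Nat.add_sub_cancel]
          exact hreach
      · refine ⟨t + 1, insert w P, a, w, Finset.card_insert_of_notMem hwP, by omega, hsub,
          by simp [ha], by simp, ?_, Or.inr (Or.inr ⟨hWc w hw, by omega, b, hq, ?_⟩)⟩
        · intro p hp y hy
          rcases Finset.mem_insert.1 hp with rfl | hp
          · exact Or.inr hy
          · exact (hcov p hp y hy).elim Or.inl (h y)
        · rw [hcard', Nat.add_sub_cancel]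
          exact hreach
    have := hmax _ hlarger
    omega

end Reach

end GroupIdent

namespace RAM

/-! ### Programs whose loops are bounded by the length of the input -/

/-- Every start in `P` leads to a halt in `Q` after at most `T` steps. -/
def Hoare (P : Mem → Prop) (p : Prog) (T : ℕ) (Q : Mem → Prop) : Prop :=
  ∀ m, P m → ∃ t ≤ T, ∃ m', Runs p m t m' ∧ Q m'

theorem Hoare.mono {P P' Q Q' : Mem → Prop} {p : Prog} {T T' : ℕ} (h : Hoare P p T Q)
    (hP : ∀ m, P' m → P m) (hT : T ≤ T') (hQ : ∀ m, Q m → Q' m) : Hoare P' p T' Q' := by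
  intro m hm
  obtain ⟨t, ht, m', hr, hq⟩ := h m (hP m hm)
  exact ⟨t, ht.trans hT, m', hr, hQ m' hq⟩

theorem Hoare.le {P Q : Mem → Prop} {p : Prog} {T T' : ℕ} (h : Hoare P p T Q) (hT : T ≤ T') :
    Hoare P p T' Q :=
  h.mono (fun _ => id) hT fun _ => id

theorem Hoare.seq {P Q R : Mem → Prop} {p q : Prog} {T T' : ℕ} (hp : Hoare P p T Q)
    (hq : Hoare Q q T' R) : Hoare P (.seq p q) (T + T') R := by
  intro m hm
  obtain ⟨t, ht, m', hr, h⟩ := hp m hm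
  obtain ⟨t', ht', m'', hr', h'⟩ := hq m' h
  exact ⟨t + t', add_le_add ht ht', m'', .seq hr hr', h'⟩

theorem Hoare.cond {P Q : Mem → Prop} {e : Expr} {p q : Prog} {T : ℕ}
    (hp : Hoare (fun m => P m ∧ e.eval m ≠ 0) p T Q)
    (hq : Hoare (fun m => P m ∧ e.eval m = 0) q T Q) :
    Hoare P (.cond e p q) (e.cost + 1 + T) Q := by
  intro m hm
  by_cases he : e.eval m = 0
  · obtain ⟨t, ht, m', hr, h⟩ := hq m ⟨hm, he⟩
    exact ⟨_, by gcongr, m', .cond_false he hr, h⟩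
  · obtain ⟨t, ht, m', hr, h⟩ := hp m ⟨hm, he⟩
    exact ⟨_, by gcongr, m', .cond_true he hr, h⟩

/-- The guard evaluates to the number of remaining rounds, so the loop makes exactly `n` rounds and
one final failing test. -/
theorem Hoare.loop {I : ℕ → Mem → Prop} {e : Expr} {p : Prog} {T n : ℕ}
    (he : ∀ i m, I i m → i ≤ n → e.eval m = n - i)
    (hp : ∀ i < n, Hoare (I i) p T (I (i + 1))) :
    Hoare (I 0) (.loop e p) (n * (e.cost + 1 + T) + (e.cost + 1)) (I n) := by
  have key : ∀ k i, i + k = n →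
      Hoare (I i) (.loop e p) (k * (e.cost + 1 + T) + (e.cost + 1)) (I n) := by
    intro k
    induction k with
    | zero =>
      rintro i rfl m hm
      exact ⟨_, by omega, m, .loop_done (by simpa using he i m hm (by omega)), hm⟩
    | succ k ih =>
      intro i hi m hm
      obtain ⟨t, ht, m', hr, h⟩ := hp i (by omega) m hm
      obtain ⟨t', ht', m'', hr', h'⟩ := ih (i + 1) (by omega) m' h
      refine ⟨_, ?_, m'', .loop_step (by rw [he i m hm (by omega)]; omega) hr hr', h'⟩
      rw [Nat.succ_mul]
      omega
  exact key n 0 (by omega)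

/-! ### Memory layout behind the input -/

/-- The memory that holds, behind the input `w`, the interleaved sequences `ρ` (variables), `τ`
(intermediate values) and `D` (a table). -/
def layout (w : List Bool) (ρ τ D : ℕ → ℕ) : Mem := fun x =>
  if x ≤ w.length then initMem w x
  else if (x - w.length - 1) % 3 = 0 then ρ ((x - w.length - 1) / 3)
  else if (x - w.length - 1) % 3 = 1 then τ ((x - w.length - 1) / 3)
  else D ((x - w.length - 1) / 3)

section layout

variable (w : List Bool) (ρ τ D : ℕ → ℕ)

/-- Cells behind the input start at `0`, so the actual initial memory already has the required
layout. -/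
theorem initMem_eq_layout : initMem w = layout w (fun _ => 0) (fun _ => 0) (fun _ => 0) := by
  funext x
  unfold layout
  split_ifs with h
  · rfl
  all_goals
    obtain ⟨i, rfl⟩ : ∃ i, x = i + 1 := ⟨x - 1, by omega⟩
    simp [initMem, List.getElem?_eq_none (show w.length ≤ i by omega)]

theorem layout_zero : layout w ρ τ D 0 = w.length := by simp [layout, initMem]

theorem layout_input {i : ℕ} (hi : i < w.length) :
    layout w ρ τ D (i + 1) = (w.getD i false).toNat := by
  rw [layout, if_pos (by omega), initMem]

theorem layout_var (v : ℕ) : layout w ρ τ D (w.length + (3 * v + 1)) = ρ v := by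
  have : w.length + (3 * v + 1) - w.length - 1 = 3 * v := by omega
  rw [layout, if_neg (by omega), this, if_pos (by omega)]
  congr 1
  omega

theorem layout_tmp (r : ℕ) : layout w ρ τ D (w.length + (3 * r + 2)) = τ r := by
  have : w.length + (3 * r + 2) - w.length - 1 = 3 * r + 1 := by omega
  rw [layout, if_neg (by omega), this, if_neg (by omega), if_pos (by omega)]
  congr 1
  omega

/-- The index is known only at run time and the machine cannot multiply, so the address uses `i + i
+ i`. -/
theorem layout_dat (i : ℕ) : layout w ρ τ D (w.length + 3 + i + i + i) = D i := by
  have : w.length + 3 + i + i + i - w.length - 1 = 3 * i + 2 := by omega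
  rw [layout, if_neg (by omega), this, if_neg (by omega), if_neg (by omega)]
  congr 1
  omega

theorem update_layout_var (v x : ℕ) :
    Function.update (layout w ρ τ D) (w.length + (3 * v + 1)) x =
      layout w (Function.update ρ v x) τ D := by
  funext y
  simp only [layout, Function.update_apply]
  grind

theorem update_layout_tmp (r x : ℕ) :
    Function.update (layout w ρ τ D) (w.length + (3 * r + 2)) x =
      layout w ρ (Function.update τ r x) D := by
  funext y
  simp only [layout, Function.update_apply]
  grind

theorem update_layout_dat (i x : ℕ) :
    Function.update (layout w ρ τ D) (w.length + 3 + i + i + i) x =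
      layout w ρ τ (Function.update D i x) := by
  funext y
  simp only [layout, Function.update_apply]
  grind

end layout

namespace Expr

/-- The length of the input. -/
def len : Expr := .read (.lit 0)

def varAddr (v : ℕ) : Expr := .add len (.lit (3 * v + 1))

def tmpAddr (r : ℕ) : Expr := .add len (.lit (3 * r + 2))

/-- The address of the table entry with index `τ r`. -/
def datAddr (r : ℕ) : Expr :=
  .add (.add (.add (.add len (.lit 3)) (.read (tmpAddr r))) (.read (tmpAddr r)))
    (.read (tmpAddr r))

def var (v : ℕ) : Expr := .read (varAddr v)

def tmp (r : ℕ) : Expr := .read (tmpAddr r)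

variable (w : List Bool) (ρ τ D : ℕ → ℕ)

@[simp] theorem eval_len : len.eval (layout w ρ τ D) = w.length := layout_zero w ρ τ D

@[simp] theorem eval_varAddr (v : ℕ) :
    (varAddr v).eval (layout w ρ τ D) = w.length + (3 * v + 1) := by simp [varAddr, eval]

@[simp] theorem eval_tmpAddr (r : ℕ) :
    (tmpAddr r).eval (layout w ρ τ D) = w.length + (3 * r + 2) := by simp [tmpAddr, eval]

@[simp] theorem eval_var (v : ℕ) : (var v).eval (layout w ρ τ D) = ρ v := by
  simp [var, eval, layout_var]

@[simp] theorem eval_tmp (r : ℕ) : (tmp r).eval (layout w ρ τ D) = τ r := by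
  simp [tmp, eval, layout_tmp]

@[simp] theorem eval_datAddr (r : ℕ) :
    (datAddr r).eval (layout w ρ τ D) = w.length + 3 + τ r + τ r + τ r := by
  simp [datAddr, eval, layout_tmp]

end Expr

/-- The memory holds `ρ`, the first `r` entries of `τ`, and `D`. -/
def Holds (w : List Bool) (r : ℕ) (ρ τ D : ℕ → ℕ) (m : Mem) : Prop :=
  ∃ τ', (∀ i < r, τ' i = τ i) ∧ m = layout w ρ τ' D

theorem Holds.mono {w : List Bool} {r r' : ℕ} {ρ τ τ₁ D : ℕ → ℕ} {m : Mem}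
    (h : Holds w r ρ τ D m) (hr : r' ≤ r) (hτ : ∀ i < r', τ i = τ₁ i) : Holds w r' ρ τ₁ D m := by
  obtain ⟨τ', hτ', rfl⟩ := h
  exact ⟨τ', fun i hi => (hτ' i (by omega)).trans (hτ i hi), rfl⟩

section store

variable {w : List Bool} {r : ℕ} {ρ τ D : ℕ → ℕ} {e : Expr} {x : ℕ}

/-- Intermediate values form a stack of which only an initial part is live. The value of `e` may
depend on live cells only, and the only cell that can become live is the one written. The constant 5
pays for the address and the store. -/
theorem hoare_store_tmp (s r' : ℕ) {τ₁ : ℕ → ℕ}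
    (he : ∀ τ', (∀ i < r, τ' i = τ i) → e.eval (layout w ρ τ' D) = x)
    (hr : ∀ i < r', i ≠ s → i < r) (hτ : ∀ i < r', Function.update τ s x i = τ₁ i) :
    Hoare (Holds w r ρ τ D) (.store (.tmpAddr s) e) (e.cost + 5) (Holds w r' ρ τ₁ D) := by
  rintro m ⟨τ', hτ', rfl⟩
  refine ⟨_, ?_, _, .store _ _ _, Function.update τ' s x, ?_, ?_⟩
  · simp [Expr.cost, Expr.tmpAddr, Expr.len]
    omega
  · intro i hi
    rw [← hτ i hi]
    by_cases his : i = s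
    · simp [his]
    · simp [his, hτ' i (hr i hi his)]
  · rw [Expr.eval_tmpAddr, update_layout_tmp, he τ' hτ']

theorem hoare_store_var (v : ℕ) {ρ₁ : ℕ → ℕ}
    (he : ∀ τ', (∀ i < r, τ' i = τ i) → e.eval (layout w ρ τ' D) = x)
    (hρ : Function.update ρ v x = ρ₁) :
    Hoare (Holds w r ρ τ D) (.store (.varAddr v) e) (e.cost + 5) (Holds w r ρ₁ τ D) := by
  rintro m ⟨τ', hτ', rfl⟩
  refine ⟨_, ?_, _, .store _ _ _, τ', hτ', ?_⟩
  · simp [Expr.cost, Expr.varAddr, Expr.len]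
    omega
  · rw [Expr.eval_varAddr, update_layout_var, he τ' hτ', hρ]

end store

/-! ### A language of bounded expressions and its compiler -/

/-- Arithmetic expressions with sums bounded by the length of the input. -/
inductive BExpr : Type
  | lit (c : ℕ)
  /-- the length of the input -/
  | len
  | var (v : ℕ)
  /-- the bit of the input at the position `e` -/
  | inp (e : BExpr)
  /-- the table entry at the position `e` -/
  | dat (e : BExpr)
  | add (e f : BExpr)
  | sub (e f : BExpr)
  /-- the product, where the first factor is cut off at the length of the input -/
  | mul (e f : BExpr)
  | ite (c e f : BExpr)
  /-- the result of accumulating the values of `e` for `v = 0, 1, …` below the length of the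
  input, where the accumulator is doubled in each step if `d = true` -/
  | fold (d : Bool) (v : ℕ) (e : BExpr)

/-- Accumulate `f 0, …, f (n - 1)`, doubling the accumulator in each step if `d = true`. -/
def accumulate (d : Bool) (f : ℕ → ℕ) : ℕ → ℕ
  | 0 => 0
  | i + 1 => (if d then accumulate d f i + accumulate d f i else accumulate d f i) + f i

namespace BExpr

def eval (w : List Bool) (D : ℕ → ℕ) : (ρ : ℕ → ℕ) → BExpr → ℕ
  | _, lit c => c
  | _, len => w.length
  | ρ, var v => ρ v
  | ρ, inp e => (w.getD (e.eval w D ρ) false).toNat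
  | ρ, dat e => D (e.eval w D ρ)
  | ρ, add e f => e.eval w D ρ + f.eval w D ρ
  | ρ, sub e f => e.eval w D ρ - f.eval w D ρ
  | ρ, mul e f => min (e.eval w D ρ) w.length * f.eval w D ρ
  | ρ, ite c e f => if c.eval w D ρ ≠ 0 then e.eval w D ρ else f.eval w D ρ
  | ρ, fold d v e => accumulate d (fun i => e.eval w D (Function.update ρ v i)) w.length

/-- A program that computes the expression into the cell for `τ r`, using no `τ i` with `i < r`. -/
def compile : BExpr → ℕ → Prog
  | lit c, r => .store (.tmpAddr r) (.lit c)
  | len, r => .store (.tmpAddr r) .len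
  | var v, r => .store (.tmpAddr r) (.var v)
  -- The guard is needed because cells behind the input hold other data, while positions past the
  -- end must read as `false`.
  | inp e, r => .seq (e.compile r) (.cond (.sub .len (.tmp r))
      (.store (.tmpAddr r) (.read (.add (.tmp r) (.lit 1)))) (.store (.tmpAddr r) (.lit 0)))
  | dat e, r => .seq (e.compile r) (.store (.tmpAddr r) (.read (.datAddr r)))
  | add e f, r => .seq (e.compile r) (.seq (f.compile (r + 1))
      (.store (.tmpAddr r) (.add (.tmp r) (.tmp (r + 1)))))
  | sub e f, r => .seq (e.compile r) (.seq (f.compile (r + 1))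
      (.store (.tmpAddr r) (.sub (.tmp r) (.tmp (r + 1)))))
  -- Repeated addition. Since `x - (x - L) = min x L`, cell `r` counts down from the cut-off factor,
  -- which bounds the number of rounds; cell `r + 2` accumulates.
  | mul e f, r => .seq (e.compile r) <| .seq (f.compile (r + 1)) <|
      .seq (.store (.tmpAddr r) (.sub (.tmp r) (.sub (.tmp r) .len))) <|
      .seq (.store (.tmpAddr (r + 2)) (.lit 0)) <|
      .seq (.loop (.tmp r) (.seq
        (.store (.tmpAddr (r + 2)) (.add (.tmp (r + 2)) (.tmp (r + 1))))
        (.store (.tmpAddr r) (.sub (.tmp r) (.lit 1)))))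
      (.store (.tmpAddr r) (.tmp (r + 2)))
  | ite c e f, r => .seq (c.compile r) (.cond (.tmp r) (e.compile r) (f.compile r))
  -- Cell `r` accumulates, and cell `r + 1` saves the outer value of `v`, which is restored at the
  -- end so that evaluation leaves the variables unchanged.
  | fold d v e, r => .seq (.store (.tmpAddr r) (.lit 0)) <|
      .seq (.store (.tmpAddr (r + 1)) (.var v)) <| .seq (.store (.varAddr v) (.lit 0)) <|
      .seq (.loop (.sub .len (.var v)) (.seq (e.compile (r + 2)) (.seq
        (.store (.tmpAddr r)
          (.add (if d then .add (.tmp r) (.tmp r) else .tmp r) (.tmp (r + 2))))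
        (.store (.varAddr v) (.add (.var v) (.lit 1))))))
      (.store (.varAddr v) (.tmp (r + 1)))

/-- The program `e.compile r` is correct and runs in polynomial time. -/
def Correct (e : BExpr) : Prop :=
  ∃ b : Polynomial ℕ, ∀ w r ρ τ D, Hoare (Holds w r ρ τ D) (e.compile r) (b.eval w.length)
    (Holds w (r + 1) ρ (Function.update τ r (e.eval w D ρ)) D)

/-- Treats `add` and `sub` together. The second operand is computed one cell higher, so that the
first survives. -/
theorem correct_binary {e f g : BExpr} (op : Expr → Expr → Expr) (opv : ℕ → ℕ → ℕ)
    (he : e.Correct) (hf : f.Correct)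
    (hop : ∀ x y m, (op x y).eval m = opv (x.eval m) (y.eval m))
    (hcost : ∀ x y, (op x y).cost = x.cost + y.cost + 1)
    (hg : ∀ w D ρ, g.eval w D ρ = opv (e.eval w D ρ) (f.eval w D ρ))
    (hc : ∀ r, g.compile r = .seq (e.compile r) (.seq (f.compile (r + 1))
      (.store (.tmpAddr r) (op (.tmp r) (.tmp (r + 1)))))) : g.Correct := by
  obtain ⟨b, hb⟩ := he
  obtain ⟨b', hb'⟩ := hf
  refine ⟨b + (b' + 30), fun w r ρ τ D => ?_⟩
  rw [hc, hg]
  refine ((hb w r ρ τ D).seq ((hb' w (r + 1) ρ _ D).seq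
    (hoare_store_tmp r (r + 1) (x := opv (e.eval w D ρ) (f.eval w D ρ)) ?_ ?_ ?_))).le ?_
  · intro τ' hτ'
    simp [hop, hτ']
  · intro i hi _
    omega
  · intro i hi
    by_cases h : i = r
    · simp [h]
    · simp [h, show i ≠ r + 1 by omega]
  · simp [hcost, Expr.cost, Expr.tmp, Expr.tmpAddr, Expr.len]

theorem correct_inp {e : BExpr} (he : e.Correct) : (inp e).Correct := by
  obtain ⟨b, hb⟩ := he
  refine ⟨b + 30, fun w r ρ τ D => ?_⟩
  refine ((hb w r ρ τ D).seq (Hoare.cond (T := 13) ?_ ?_)).le ?_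
  · rintro m ⟨⟨τ', hτ', rfl⟩, hm⟩
    have hr := hτ' r (by omega)
    rw [Function.update_self] at hr
    have hlt : e.eval w D ρ < w.length := by
      simp [Expr.eval, hr] at hm
      omega
    refine (hoare_store_tmp (τ := τ') (r := r + 1) r (r + 1)
      (x := (w.getD (e.eval w D ρ) false).toNat) ?_ ?_ ?_).le ?_ _ ⟨τ', fun _ _ => rfl, rfl⟩
    · intro τ₂ h₂
      rw [Expr.eval, Expr.eval, Expr.eval_tmp, h₂ r (by omega), hr]
      exact layout_input w ρ τ₂ D hlt
    · intro i hi _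
      omega
    · intro i hi
      by_cases h : i = r
      · simp [h, eval]
      · simp [h, hτ' i hi]
    · simp [Expr.cost, Expr.tmp, Expr.tmpAddr, Expr.len]
  · rintro m ⟨⟨τ', hτ', rfl⟩, hm⟩
    have hr := hτ' r (by omega)
    rw [Function.update_self] at hr
    have hle : w.length ≤ e.eval w D ρ := by
      simp [Expr.eval, hr] at hm
      omega
    refine (hoare_store_tmp (τ := τ') (r := r + 1) r (r + 1)
      (x := 0) ?_ ?_ ?_).le ?_ _ ⟨τ', fun _ _ => rfl, rfl⟩
    · intro τ₂ h₂
      rfl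
    · intro i hi _
      omega
    · intro i hi
      by_cases h : i = r
      · simp [h, eval, List.getElem?_eq_none hle]
      · simp [h, hτ' i hi]
    · simp [Expr.cost]
  · simp [Expr.cost, Expr.tmp, Expr.tmpAddr, Expr.len]

theorem correct_dat {e : BExpr} (he : e.Correct) : (dat e).Correct := by
  obtain ⟨b, hb⟩ := he
  refine ⟨b + 40, fun w r ρ τ D => ?_⟩
  refine ((hb w r ρ τ D).seq (hoare_store_tmp r (r + 1) (x := D (e.eval w D ρ)) ?_ ?_ ?_)).le ?_
  · intro τ' hτ'
    rw [Expr.eval, Expr.eval_datAddr, hτ' r (by omega), Function.update_self, layout_dat]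
  · intro i hi _
    omega
  · intro i hi
    simp [eval]
  · simp [Expr.cost, Expr.datAddr, Expr.tmpAddr, Expr.len]

theorem correct_ite {c e f : BExpr} (hc : c.Correct) (he : e.Correct) (hf : f.Correct) :
    (ite c e f).Correct := by
  obtain ⟨b, hb⟩ := hc
  obtain ⟨b₁, hb₁⟩ := he
  obtain ⟨b₂, hb₂⟩ := hf
  refine ⟨b + (6 + (b₁ + b₂)), fun w r ρ τ D => ?_⟩
  -- Both branches reuse cell `r`, so the value of the condition is given up after the test.
  have weaken : ∀ m, Holds w (r + 1) ρ (Function.update τ r (c.eval w D ρ)) D m →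
      Holds w r ρ τ D m := fun m h => h.mono (by omega) fun i hi => by
    simp [show i ≠ r by omega]
  have value : ∀ m, Holds w (r + 1) ρ (Function.update τ r (c.eval w D ρ)) D m →
      (Expr.tmp r).eval m = c.eval w D ρ := by
    rintro m ⟨τ', hτ', rfl⟩
    simp [hτ']
  refine ((hb w r ρ τ D).seq (Hoare.cond (T := b₁.eval w.length + b₂.eval w.length) ?_ ?_)).le ?_
  · rintro m ⟨hm, hm'⟩
    rw [value m hm] at hm'
    rw [eval, if_pos hm']
    exact (hb₁ w r ρ τ D).le (by omega) m (weaken m hm)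
  · rintro m ⟨hm, hm'⟩
    rw [value m hm] at hm'
    rw [eval, if_neg (by simpa using hm')]
    exact (hb₂ w r ρ τ D).le (by omega) m (weaken m hm)
  · simp [Expr.cost, Expr.tmp, Expr.tmpAddr, Expr.len]

theorem correct_mul {e f : BExpr} (he : e.Correct) (hf : f.Correct) : (mul e f).Correct := by
  obtain ⟨b, hb⟩ := he
  obtain ⟨b', hb'⟩ := hf
  refine ⟨b + (b' + (100 + 100 * Polynomial.X)), fun w r ρ τ D => ?_⟩
  set x := e.eval w D ρ with hx
  set y := f.eval w D ρ with hy
  -- The intermediate values after `i` additions.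
  let σ : ℕ → ℕ → ℕ := fun i => Function.update (Function.update (Function.update τ r
    (min x w.length - i)) (r + 1) y) (r + 2) (i * y)
  refine ((hb w r ρ τ D).seq ((hb' w (r + 1) ρ _ D).seq
    ((hoare_store_tmp r (r + 2) (x := min x w.length)
      (τ₁ := Function.update (Function.update τ r (min x w.length)) (r + 1) y) ?_ ?_ ?_).seq
    ((hoare_store_tmp (r + 2) (r + 3) (x := 0) (τ₁ := σ 0) ?_ ?_ ?_).seq
    ((Hoare.loop (I := fun i => Holds w (r + 3) ρ (σ i) D) (n := min x w.length) (T := 40)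
      ?_ ?_).seq
    (hoare_store_tmp r (r + 1) (x := min x w.length * y) ?_ ?_ ?_)))))).le ?_
  · intro τ' hτ'
    simp [Expr.eval, hτ', ← hx]
    omega
  · intro i hi _
    omega
  · intro i hi
    simp only [Function.update_apply]
    grind
  · intro τ' hτ'
    rfl
  · intro i hi _
    omega
  · intro i hi
    simp only [σ, Function.update_apply]
    grind
  · rintro i m ⟨τ', hτ', rfl⟩ hi
    simp [hτ', σ]
  · intro i hi
    refine ((hoare_store_tmp (r + 2) (r + 3) (x := (i + 1) * y)
      (τ₁ := Function.update (σ i) (r + 2) ((i + 1) * y)) ?_ ?_ ?_).seq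
      (hoare_store_tmp r (r + 3) (x := min x w.length - (i + 1)) ?_ ?_ ?_)).le ?_
    · intro τ' hτ'
      simp [Expr.eval, hτ', σ]
      ring
    · intro i hi _
      omega
    · intro i hi
      rfl
    · intro τ' hτ'
      simp [Expr.eval, hτ', σ]
      omega
    · intro i hi _
      omega
    · intro j hj
      simp only [σ, Function.update_apply]
      grind
    · simp [Expr.cost, Expr.tmp, Expr.tmpAddr, Expr.len]
  · intro τ' hτ'
    simp [hτ', σ]
  · intro i hi _
    omega
  · intro i hi
    simp only [σ, Function.update_apply, eval]
    grind
  · simp [Expr.cost, Expr.tmp, Expr.tmpAddr, Expr.len]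
    omega

theorem correct_fold {d : Bool} {v : ℕ} {e : BExpr} (he : e.Correct) : (fold d v e).Correct := by
  obtain ⟨b, hb⟩ := he
  refine ⟨100 + Polynomial.X * (b + 100), fun w r ρ τ D => ?_⟩
  set f : ℕ → ℕ := fun i => e.eval w D (Function.update ρ v i) with hf
  -- After `i` rounds: the partial accumulation, and above it the saved value of `v`.
  let σ : ℕ → ℕ → ℕ := fun i => Function.update (Function.update τ r (accumulate d f i))
    (r + 1) (ρ v)
  refine ((hoare_store_tmp r (r + 1) (x := 0) (τ₁ := Function.update τ r 0) ?_ ?_ ?_).seq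
    ((hoare_store_tmp (r + 1) (r + 2) (x := ρ v) (τ₁ := σ 0) ?_ ?_ ?_).seq
    ((hoare_store_var v (x := 0) (ρ₁ := Function.update ρ v 0) ?_ rfl).seq
    ((Hoare.loop (I := fun i => Holds w (r + 2) (Function.update ρ v i) (σ i) D) (n := w.length)
      (T := b.eval w.length + 40) ?_ ?_).seq
    ((hoare_store_var v (x := ρ v) (ρ₁ := ρ) ?_ (by simp)).mono (fun _ => id) le_rfl
      ?_))))).le ?_
  · intro τ' hτ'
    rfl
  · intro i hi _
    omega
  · intro i hi
    rfl
  · intro τ' hτ'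
    simp
  · intro i hi _
    omega
  · intro i hi
    rfl
  · intro τ' hτ'
    rfl
  · rintro i m ⟨τ', hτ', rfl⟩ hi
    simp [Expr.eval]
  · intro i hi
    refine ((hb w (r + 2) (Function.update ρ v i) (σ i) D).seq
      ((hoare_store_tmp r (r + 2) (x := accumulate d f (i + 1)) (τ₁ := σ (i + 1)) ?_ ?_ ?_).seq
      (hoare_store_var v (x := i + 1) ?_ ?_))).le ?_
    · intro τ' hτ'
      cases d <;> simp [Expr.eval, hτ', σ, accumulate, hf]
    · intro i hi _
      omega
    · intro j hj
      simp only [σ, Function.update_apply]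
      grind
    · intro τ' hτ'
      simp [Expr.eval]
    · simp
    · cases d <;> simp [Expr.cost, Expr.tmp, Expr.tmpAddr, Expr.var, Expr.varAddr, Expr.len]
  · intro τ' hτ'
    simp [hτ', σ]
  · intro m hm
    refine hm.mono (by omega) fun i hi => ?_
    simp only [σ, Function.update_apply, eval, ← hf]
    grind
  · simp [Expr.cost, Expr.tmp, Expr.tmpAddr, Expr.var, Expr.varAddr, Expr.len]
    ring_nf
    omega

theorem correct (e : BExpr) : e.Correct := by
  induction e with
  | lit c =>
    refine ⟨20, fun w r ρ τ D => (hoare_store_tmp r (r + 1) (fun _ _ => rfl)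
      (fun i hi _ => by omega) fun _ _ => rfl).le (by simp [Expr.cost])⟩
  | len =>
    refine ⟨20, fun w r ρ τ D => (hoare_store_tmp r (r + 1) (fun _ _ => Expr.eval_len _ _ _ _)
      (fun i hi _ => by omega) fun _ _ => rfl).le (by simp [Expr.cost, Expr.len])⟩
  | var v =>
    refine ⟨20, fun w r ρ τ D => (hoare_store_tmp r (r + 1) (fun _ _ => Expr.eval_var _ _ _ _ _)
      (fun i hi _ => by omega) fun _ _ => rfl).le
        (by simp [Expr.cost, Expr.var, Expr.varAddr, Expr.len])⟩
  | inp e ih => exact correct_inp ih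
  | dat e ih => exact correct_dat ih
  | add e f he hf =>
    exact correct_binary .add (· + ·) he hf (fun _ _ _ => rfl) (fun _ _ => rfl)
      (fun _ _ _ => rfl) fun _ => rfl
  | sub e f he hf =>
    exact correct_binary .sub (· - ·) he hf (fun _ _ _ => rfl) (fun _ _ => rfl)
      (fun _ _ _ => rfl) fun _ => rfl
  | mul e f he hf => exact correct_mul he hf
  | ite c e f hc he hf => exact correct_ite hc he hf
  | fold d v e he => exact correct_fold he

end BExpr

/-! ### Commands built from bounded loops -/

/-- Commands that fill the table. -/
inductive Cmd : Type
  /-- set the table entry at the position `i` to the value of `e` -/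
  | set (i e : BExpr)
  /-- run `c` for `v = 0, 1, …` below the length of the input -/
  | loop (v : ℕ) (c : Cmd)

namespace Cmd

/-- The table after `n` rounds of `c`. -/
def rounds (c : ℕ → (ℕ → ℕ) → ℕ → ℕ) (D : ℕ → ℕ) : ℕ → ℕ → ℕ
  | 0 => D
  | i + 1 => c i (rounds c D i)

def exec (w : List Bool) : (ρ : ℕ → ℕ) → Cmd → (ℕ → ℕ) → ℕ → ℕ
  | ρ, set i e, D => Function.update D (i.eval w D ρ) (e.eval w D ρ)
  | ρ, loop v c, D => rounds (fun i => c.exec w (Function.update ρ v i)) D w.length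

def compile : Cmd → ℕ → Prog
  | set i e, r => .seq (i.compile r) (.seq (e.compile (r + 1))
      (.store (.datAddr r) (.tmp (r + 1))))
  | loop v c, r => .seq (.store (.tmpAddr r) (.var v)) <| .seq (.store (.varAddr v) (.lit 0)) <|
      .seq (.loop (.sub .len (.var v)) (.seq (c.compile (r + 1))
        (.store (.varAddr v) (.add (.var v) (.lit 1)))))
      (.store (.varAddr v) (.tmp r))

/-- Each loop multiplies a polynomial by the input length, up to overhead. The bound must be uniform
in `D`, as the table changes from round to round. -/
theorem correct (c : Cmd) : ∃ b : Polynomial ℕ, ∀ w r ρ τ D,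
    Hoare (Holds w r ρ τ D) (c.compile r) (b.eval w.length) (Holds w r ρ τ (c.exec w ρ D)) := by
  induction c with
  | set i e =>
    obtain ⟨b, hb⟩ := i.correct
    obtain ⟨b', hb'⟩ := e.correct
    refine ⟨b + (b' + 40), fun w r ρ τ D => ?_⟩
    refine ((hb w r ρ τ D).seq ((hb' w (r + 1) ρ _ D).seq (T' := 40) ?_)).le (by simp)
    rintro m ⟨τ', hτ', rfl⟩
    refine ⟨_, ?_, _, .store _ _ _, τ', fun j hj => ?_, ?_⟩
    · simp [Expr.cost, Expr.datAddr, Expr.tmp, Expr.tmpAddr, Expr.len]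
    · rw [hτ' j (by omega)]
      simp [show j ≠ r by omega, show j ≠ r + 1 by omega]
    · rw [Expr.eval_datAddr, update_layout_dat]
      simp [hτ', exec]
  | loop v c ih =>
    obtain ⟨b, hb⟩ := ih
    refine ⟨100 + Polynomial.X * (b + 100), fun w r ρ τ D => ?_⟩
    let Dn := rounds (fun i => c.exec w (Function.update ρ v i)) D
    refine ((hoare_store_tmp r (r + 1) (x := ρ v) (τ₁ := Function.update τ r (ρ v)) ?_ ?_ ?_).seq
      ((hoare_store_var v (x := 0) (ρ₁ := Function.update ρ v 0) ?_ rfl).seq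
      ((Hoare.loop (I := fun i => Holds w (r + 1) (Function.update ρ v i)
        (Function.update τ r (ρ v)) (Dn i)) (n := w.length) (T := b.eval w.length + 40) ?_ ?_).seq
      ((hoare_store_var v (x := ρ v) (ρ₁ := ρ) ?_ (by simp)).mono (fun _ => id) le_rfl
      ?_)))).le ?_
    · intro τ' hτ'
      simp
    · intro i hi _
      omega
    · intro i hi
      rfl
    · intro τ' hτ'
      rfl
    · rintro i m ⟨τ', hτ', rfl⟩ hi
      simp [Expr.eval]
    · intro i hi
      refine ((hb w (r + 1) (Function.update ρ v i) _ (Dn i)).seq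
        (hoare_store_var v (x := i + 1) ?_ ?_)).le ?_
      · intro τ' hτ'
        simp [Expr.eval]
      · simp
      · simp [Expr.cost, Expr.var, Expr.varAddr, Expr.len]
    · intro τ' hτ'
      simp [hτ']
    · intro m hm
      exact hm.mono (by omega) fun i hi => by simp [show i ≠ r by omega]
    · simp [Expr.cost, Expr.tmp, Expr.tmpAddr, Expr.var, Expr.varAddr, Expr.len]
      ring_nf
      omega

end Cmd

/-- A problem is solvable in polynomial time if a bounded command fills a table from which a bounded
expression reads the answer. -/
theorem polyTimeSolvableOn_of_cmd {α : Type*} {encode : α → List Bool} {dom yes : α → Prop}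
    (c : Cmd) (e : BExpr)
    (h : ∀ x, dom x →
      (e.eval (encode x) (c.exec (encode x) (fun _ => 0) fun _ => 0) (fun _ => 0) ≠ 0 ↔ yes x)) :
    PolyTimeSolvableOn encode dom yes := by
  obtain ⟨b, hb⟩ := c.correct
  obtain ⟨b', hb'⟩ := (BExpr.ite e (.lit 1) (.lit 0)).correct
  -- The conditional normalises the answer to `0` or `1`. Overwriting the input length in cell `0`
  -- is harmless in the last instruction.
  refine ⟨.seq (c.compile 0) (.seq ((BExpr.ite e (.lit 1) (.lit 0)).compile 0)
    (.store (.lit 0) (.tmp 0))), b + (b' + 10), fun x hx => ?_⟩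
  set w := encode x
  obtain ⟨t, ht, m, hr, hm⟩ := hb w 0 (fun _ => 0) (fun _ => 0) (fun _ => 0) (initMem w)
    ⟨_, fun _ _ => rfl, initMem_eq_layout w⟩
  obtain ⟨t', ht', m', hr', τ', hτ', rfl⟩ := hb' w 0 _ _ _ m hm
  refine ⟨_, _, .seq hr (.seq hr' (.store _ _ _)), ?_, ?_, ?_⟩
  · simp [Expr.cost, Expr.tmp, Expr.tmpAddr, Expr.len]
    omega
  all_goals
    intro hy
    rw [← h x hx] at hy
    rw [Expr.eval_tmp, hτ' 0 (by omega)]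
    simp only [Expr.eval, Function.update_self, BExpr.eval]
  · rw [if_pos hy]
  · rw [if_neg hy]

end RAM

/-! ### Logical connectives, bounded quantifiers and the filling of tables -/

namespace RAM

namespace BExpr

/-- The value of the expression is not `0`. -/
def Truthy (w : List Bool) (D ρ : ℕ → ℕ) (e : BExpr) : Prop := e.eval w D ρ ≠ 0

protected def not (e : BExpr) : BExpr := ite e (lit 0) (lit 1)

protected def and (e f : BExpr) : BExpr := ite e f (lit 0)

protected def or (e f : BExpr) : BExpr := ite e (lit 1) f

protected def lt (e f : BExpr) : BExpr := sub f e

protected def le (e f : BExpr) : BExpr := (BExpr.lt f e).not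

protected def eq (e f : BExpr) : BExpr := (BExpr.le e f).and (BExpr.le f e)

/-- `e` is true for some value of `v` below the length of the input. -/
def ex (v : ℕ) (e : BExpr) : BExpr := fold false v e

/-- `e` is true for all values of `v` below the length of the input. -/
def all (v : ℕ) (e : BExpr) : BExpr := (ex v e.not).not

variable {w : List Bool} {D ρ : ℕ → ℕ} {e f : BExpr}

theorem truthy_not : e.not.Truthy w D ρ ↔ ¬ e.Truthy w D ρ := by
  by_cases h : e.eval w D ρ = 0 <;> simp [Truthy, BExpr.not, eval, h]

theorem truthy_and : (e.and f).Truthy w D ρ ↔ e.Truthy w D ρ ∧ f.Truthy w D ρ := by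
  by_cases h : e.eval w D ρ = 0 <;> simp [Truthy, BExpr.and, eval, h]

theorem truthy_or : (e.or f).Truthy w D ρ ↔ e.Truthy w D ρ ∨ f.Truthy w D ρ := by
  by_cases h : e.eval w D ρ = 0 <;> simp [Truthy, BExpr.or, eval, h]

theorem truthy_lt : (e.lt f).Truthy w D ρ ↔ e.eval w D ρ < f.eval w D ρ := by
  simp [Truthy, BExpr.lt, eval, Nat.sub_eq_zero_iff_le]

theorem truthy_le : (e.le f).Truthy w D ρ ↔ e.eval w D ρ ≤ f.eval w D ρ := by
  simp [BExpr.le, truthy_not, truthy_lt]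

theorem truthy_eq : (e.eq f).Truthy w D ρ ↔ e.eval w D ρ = f.eval w D ρ := by
  simp [BExpr.eq, truthy_and, truthy_le, le_antisymm_iff]

theorem truthy_inp : (inp e).Truthy w D ρ ↔ w.getD (e.eval w D ρ) false = true := by
  simp [Truthy, eval]

theorem accumulate_false (f : ℕ → ℕ) (n : ℕ) :
    accumulate false f n = ∑ i ∈ Finset.range n, f i := by
  induction n with
  | zero => rfl
  | succ n ih => rw [Finset.sum_range_succ, ← ih]; rfl

/-- A sum of natural numbers is nonzero exactly when some summand is, so the summands need not be
normalised. -/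
theorem truthy_ex {v : ℕ} :
    (ex v e).Truthy w D ρ ↔ ∃ i < w.length, e.Truthy w D (Function.update ρ v i) := by
  simp [Truthy, ex, eval, accumulate_false]

theorem truthy_all {v : ℕ} :
    (all v e).Truthy w D ρ ↔ ∀ i < w.length, e.Truthy w D (Function.update ρ v i) := by
  simp [all, truthy_not, truthy_ex]

end BExpr

/-- The first `N` entries of the table `D` agree with `F`. -/
def AgreeBelow (F : ℕ → ℕ) (N : ℕ) (D : ℕ → ℕ) : Prop := ∀ m < N, D m = F m

/-- Table positions are numerals in base `w.length`: `M` is the prefix of digits fixed by the outer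
loops, and this loop runs through the next digit, leaving `k` digits free. Nested loops thus fill
the table in increasing order, and everything before the current position is already correct. -/
theorem AgreeBelow.loop {F : ℕ → ℕ} {w : List Bool} {v : ℕ} {c : Cmd} {ρ : ℕ → ℕ} {M k : ℕ}
    (h : ∀ i < w.length, ∀ D, AgreeBelow F ((w.length * M + i) * w.length ^ k) D →
      AgreeBelow F ((w.length * M + i + 1) * w.length ^ k)
        (c.exec w (Function.update ρ v i) D))
    {D : ℕ → ℕ} (h0 : AgreeBelow F (M * w.length ^ (k + 1)) D) :
    AgreeBelow F ((M + 1) * w.length ^ (k + 1)) ((Cmd.loop v c).exec w ρ D) := by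
  have key : ∀ i ≤ w.length, AgreeBelow F ((w.length * M + i) * w.length ^ k)
      (Cmd.rounds (fun i => c.exec w (Function.update ρ v i)) D i) := by
    intro i
    induction i with
    | zero =>
      intro _
      rwa [add_zero, show w.length * M * w.length ^ k = M * w.length ^ (k + 1) by ring]
    | succ i ih => exact fun hi => h i hi _ (ih (by omega))
  have := key w.length le_rfl
  rwa [show (w.length * M + w.length) * w.length ^ k = (M + 1) * w.length ^ (k + 1) by ring]
    at this

end RAM

/-! ### Reading an instance back from its encoding -/

namespace GroupIdent

open RAM

namespace GCAIInstance

variable (I : GCAIInstance)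

section encode

theorem getD_append_length_add (l l' : List Bool) {m : ℕ} (hm : l.length = m) (i : ℕ) :
    (l ++ l').getD (m + i) false = l'.getD i false := by
  subst hm
  simp [List.getElem?_append_right]

theorem getD_append_of_lt (l l' : List Bool) {i : ℕ} (hi : i < l.length) :
    (l ++ l').getD i false = l.getD i false := by
  simp [List.getElem?_append_left hi]

theorem getD_map_finRange {n : ℕ} (f : Fin n → Bool) (a : Fin n) :
    ((List.finRange n).map f).getD a false = f a := by
  simp

theorem length_flatMap_map {α β : Type*} (l : List α) (l' : List β) (f : α → β → Bool) :
    (l.flatMap fun a => l'.map (f a)).length = l.length * l'.length := by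
  simp [List.length_flatMap]

theorem getD_flatMap_map {α β : Type*} (l : List α) (l' : List β) (f : α → β → Bool) (i : ℕ)
    (hi : i < l.length) (j : ℕ) (hj : j < l'.length) :
    (l.flatMap fun a => l'.map (f a)).getD (l'.length * i + j) false = f l[i] l'[j] := by
  induction l generalizing i with
  | nil => simp at hi
  | cons a l ih =>
    rw [List.flatMap_cons]
    cases i with
    | zero =>
      rw [getD_append_of_lt _ _ (by simpa using hj)]
      simp [hj]
    | succ i =>
      rw [show l'.length * (i + 1) + j = l'.length + (l'.length * i + j) by ring,
        getD_append_length_add _ _ (by simp), ih i (by simpa using hi)]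
      rfl

/-- The position of the sign of `k` in the encoding. -/
def signPos : ℕ := 3 * I.n + 1 + I.n * I.n

theorem length_encode : I.encode.length = I.signPos + 1 + (Nat.bits I.k.natAbs).length := by
  simp only [encode, List.length_append, List.length_replicate, List.length_map,
    List.length_finRange, length_flatMap_map, List.length_singleton, signPos]
  omega

/-- Consequently quantifiers bounded by the input length reach every individual, and products with
first factor `n` are not cut off. -/
theorem n_lt_length_encode : I.n < I.encode.length := by
  rw [length_encode, signPos]
  omega

theorem getD_encode_lt {i : ℕ} (hi : i < I.n) : I.encode.getD i false = true := by
  simp only [encode, List.append_assoc]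
  rw [getD_append_of_lt _ _ (by simpa using hi)]
  simp [hi]

theorem getD_encode_n : I.encode.getD I.n false = false := by
  simp only [encode, List.append_assoc]
  exact getD_append_length_add _ _ List.length_replicate 0

theorem getD_encode_S (a : Fin I.n) :
    I.encode.getD (I.n + (1 + a)) false = decide (a ∈ I.S) := by
  simp only [encode, List.append_assoc]
  rw [getD_append_length_add _ _ (by simp), getD_append_length_add _ _ (by simp),
    getD_append_of_lt _ _ (by simp), getD_map_finRange]

theorem getD_encode_T (a : Fin I.n) :
    I.encode.getD (I.n + (1 + (I.n + a))) false = decide (a ∈ I.T) := by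
  simp only [encode, List.append_assoc]
  rw [getD_append_length_add _ _ (by simp), getD_append_length_add _ _ (by simp),
    getD_append_length_add _ _ (by simp), getD_append_of_lt _ _ (by simp), getD_map_finRange]

theorem getD_encode_φ (a b : Fin I.n) :
    I.encode.getD (I.n + (1 + (I.n + (I.n + (I.n * a + b))))) false = I.φ a b := by
  simp only [encode, List.append_assoc]
  rw [getD_append_length_add _ _ (by simp), getD_append_length_add _ _ (by simp),
    getD_append_length_add _ _ (by simp), getD_append_length_add _ _ (by simp),
    getD_append_of_lt]
  · have := getD_flatMap_map (List.finRange I.n) (List.finRange I.n) I.φ a (by simp) b (by simp)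
    simpa using this
  · rw [length_flatMap_map, List.length_finRange]
    calc I.n * a + b < I.n * a + I.n := by omega
      _ = I.n * (a + 1) := by ring
      _ ≤ I.n * I.n := Nat.mul_le_mul_left _ a.2

theorem encode_eq_append : ∃ l : List Bool, l.length = I.signPos ∧
    I.encode = l ++ (decide (I.k < 0) :: Nat.bits I.k.natAbs) := by
  refine ⟨_, ?_, by rw [encode, List.append_assoc _ [_]]; rfl⟩
  simp only [List.length_append, List.length_replicate, List.length_map,
    List.length_finRange, length_flatMap_map, List.length_singleton, signPos]
  omega

theorem getD_encode_sign : I.encode.getD I.signPos false = decide (I.k < 0) := by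
  obtain ⟨l, hl, h⟩ := I.encode_eq_append
  rw [h, ← add_zero I.signPos, getD_append_length_add _ _ hl]
  rfl

theorem drop_encode : I.encode.drop (I.signPos + 1) = Nat.bits I.k.natAbs := by
  obtain ⟨l, hl, h⟩ := I.encode_eq_append
  rw [h, ← hl, ← List.drop_drop, List.drop_left]
  rfl

/-- Horner's rule from the most significant bit down to position `p`. Positions past the end read as
leading zeros, so the loop may run for the whole input length. -/
theorem accumulate_true_drop (w : List Bool) (p m : ℕ) (hm : m ≤ w.length) :
    accumulate true (fun i => (w.getD (p + (w.length - 1 - i)) false).toNat) m =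
      Nat.ofDigits 2 ((w.drop (p + (w.length - m))).map Bool.toNat) := by
  induction m with
  | zero => simp [accumulate, List.drop_eq_nil_of_le]
  | succ m ih =>
    simp only [accumulate, if_true]
    rw [ih (by omega)]
    set q := p + (w.length - (m + 1)) with hq
    rw [show p + (w.length - m) = q + 1 by omega, show p + (w.length - 1 - m) = q by omega]
    by_cases h : q < w.length
    · rw [List.drop_eq_getElem_cons h, List.map_cons, Nat.ofDigits_cons]
      simp [h]
      ring
    · simp [List.drop_eq_nil_of_le (not_lt.1 h), List.drop_eq_nil_of_le (show w.length ≤ q + 1 by omega),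
        List.getElem?_eq_none (not_lt.1 h)]

theorem ofDigits_bits (m : ℕ) : Nat.ofDigits 2 (m.bits.map Bool.toNat) = m := by
  have h := Nat.ofDigits_digits 2 m
  rw [Nat.digits_two_eq_bits] at h
  convert h using 3
  funext b
  cases b <;> rfl

end encode

/-- `a` and `b` are the numbers of individuals the first of whom qualifies the second. -/
def Qualifies (a b : ℕ) : Prop := ∃ (ha : a < I.n) (hb : b < I.n), I.φ ⟨a, ha⟩ ⟨b, hb⟩ = true

/-- `a` is the number of an individual in `A`. -/
def HasNumber (A : Finset (Fin I.n)) (a : ℕ) : Prop := ∃ ha : a < I.n, (⟨a, ha⟩ : Fin I.n) ∈ A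

open Classical in
/-- The price of the individual with the number `a`. -/
noncomputable def priceOf (a : ℕ) : ℕ := if I.HasNumber I.T a then 0 else 1

/-- `PairReach` for the numbers of individuals. -/
def Reach (t x c a b : ℕ) : Prop := ∃ (hc : c < I.n) (ha : a < I.n) (hb : b < I.n),
  PairReach I.φ I.T ⟨c, hc⟩ t x ⟨a, ha⟩ ⟨b, hb⟩

theorem priceOf_eq {a : ℕ} (ha : a < I.n) : I.priceOf a = price I.T ⟨a, ha⟩ := by
  simp [priceOf, price, HasNumber, ha]

theorem reach_zero {x c a b : ℕ} :
    I.Reach 0 x c a b ↔ c < I.n ∧ a = c ∧ b = c ∧ x = I.priceOf c := by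
  constructor
  · rintro ⟨hc, ha, hb, h1, h2, h3⟩
    exact ⟨hc, by simpa using h1, by simpa using h2, by rw [I.priceOf_eq hc, h3]⟩
  · rintro ⟨hc, rfl, rfl, h⟩
    exact ⟨hc, hc, hc, rfl, rfl, by rw [h, I.priceOf_eq hc]⟩

theorem reach_succ {t x c a b : ℕ} :
    I.Reach (t + 1) x c a b ↔ I.Reach t x c a b ∨
      (I.Qualifies a c ∧ I.priceOf a ≤ x ∧ ∃ a', (I.Qualifies a' a ∨ I.Qualifies b a) ∧
        I.Reach t (x - I.priceOf a) c a' b) ∨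
      (I.Qualifies b c ∧ I.priceOf b ≤ x ∧ ∃ b', (I.Qualifies a b ∨ I.Qualifies b' b) ∧
        I.Reach t (x - I.priceOf b) c a b') := by
  constructor
  · rintro ⟨hc, ha, hb, h | ⟨hq, hx, a', hq', h⟩ | ⟨hq, hx, b', hq', h⟩⟩
    · exact Or.inl ⟨hc, ha, hb, h⟩
    · rw [← I.priceOf_eq ha] at hx h
      exact Or.inr (Or.inl ⟨⟨ha, hc, hq⟩, hx, a', hq'.imp (fun h => ⟨a'.2, ha, h⟩)
        (fun h => ⟨hb, ha, h⟩), hc, a'.2, hb, h⟩)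
    · rw [← I.priceOf_eq hb] at hx h
      exact Or.inr (Or.inr ⟨⟨hb, hc, hq⟩, hx, b', hq'.imp (fun h => ⟨ha, hb, h⟩)
        (fun h => ⟨b'.2, hb, h⟩), hc, ha, b'.2, h⟩)
  · rintro (⟨hc, ha, hb, h⟩ | ⟨⟨ha, hc, hq⟩, hx, a', hq', _, ha', hb, h⟩ |
      ⟨⟨hb, hc, hq⟩, hx, b', hq', _, ha, hb', h⟩)
    · exact ⟨hc, ha, hb, Or.inl h⟩
    · rw [I.priceOf_eq ha] at hx h
      exact ⟨hc, ha, hb, Or.inr (Or.inl ⟨hq, hx, ⟨a', ha'⟩,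
        hq'.imp (fun h => h.2.2) (fun h => h.2.2), h⟩)⟩
    · rw [I.priceOf_eq hb] at hx h
      exact ⟨hc, ha, hb, Or.inr (Or.inr ⟨hq, hx, ⟨b', hb'⟩,
        hq'.imp (fun h => h.2.2) (fun h => h.2.2), h⟩)⟩

end GCAIInstance

/-! ### The algorithm -/

open BExpr

/-- The number of individuals. -/
def sizeExpr : BExpr :=
  -- Counts the positions up to which no zero has occurred, that is, the length of the unary prefix.
  fold false 10 (ite (ex 11 ((BExpr.le (var 11) (var 10)).and (inp (var 11)).not)) (lit 0) (lit 1))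

/-- The offsets follow the encoding. Without the range checks, an index of at least `n` would read
an unrelated bit. -/
def qualExpr (e f : BExpr) : BExpr :=
  ((BExpr.lt e sizeExpr).and (BExpr.lt f sizeExpr)).and
    (inp (add sizeExpr (add (lit 1) (add sizeExpr (add sizeExpr (add (mul sizeExpr e) f))))))

def memSExpr (e : BExpr) : BExpr :=
  (BExpr.lt e sizeExpr).and (inp (add sizeExpr (add (lit 1) e)))

def memTExpr (e : BExpr) : BExpr :=
  (BExpr.lt e sizeExpr).and (inp (add sizeExpr (add (lit 1) (add sizeExpr e))))

def priceExpr (e : BExpr) : BExpr := ite (memTExpr e) (lit 0) (lit 1)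

def signPosExpr : BExpr :=
  add (add (add sizeExpr (add sizeExpr sizeExpr)) (lit 1)) (mul sizeExpr sizeExpr)

/-- The absolute value of `k`. -/
def boundExpr : BExpr :=
  fold true 12 (inp (add (add signPosExpr (lit 1)) (sub (sub len (lit 1)) (var 12))))

/-- The position of the table entry for five given indices. -/
def codeExpr (t x c a b : BExpr) : BExpr :=
  -- The first factor is the cut-off bound itself, so these products are exact.
  add (mul len (add (mul len (add (mul len (add (mul len t) x)) c)) a)) b

/-- The truth value of `Reach` in terms of those at earlier positions of the table, where the
variables `0, …, 4` are the step number, the price, and the three individuals. -/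
def reachExpr : BExpr :=
  ite (var 0)
    ((dat (codeExpr (sub (var 0) (lit 1)) (var 1) (var 2) (var 3) (var 4))).or
      (((qualExpr (var 3) (var 2)).and ((BExpr.le (priceExpr (var 3)) (var 1)).and
        (ex 5 (((qualExpr (var 5) (var 3)).or (qualExpr (var 4) (var 3))).and
          (dat (codeExpr (sub (var 0) (lit 1)) (sub (var 1) (priceExpr (var 3))) (var 2) (var 5)
            (var 4))))))).or
      ((qualExpr (var 4) (var 2)).and ((BExpr.le (priceExpr (var 4)) (var 1)).and
        (ex 5 (((qualExpr (var 3) (var 4)).or (qualExpr (var 5) (var 4))).and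
          (dat (codeExpr (sub (var 0) (lit 1)) (sub (var 1) (priceExpr (var 4))) (var 2) (var 3)
            (var 5)))))))))
    ((BExpr.lt (var 2) sizeExpr).and ((BExpr.eq (var 3) (var 2)).and
      ((BExpr.eq (var 4) (var 2)).and (BExpr.eq (var 1) (priceExpr (var 2))))))

/-- With the step number in the outermost loop, every entry that is consulted has been computed
before. -/
def reachCmd : Cmd :=
  .loop 0 (.loop 1 (.loop 2 (.loop 3 (.loop 4
    (.set (codeExpr (var 0) (var 1) (var 2) (var 3) (var 4)) (ite reachExpr (lit 1) (lit 0)))))))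

/-- The sign is tested first because `boundExpr` yields only `|k|`. Variable 1 is the price, 2 the
consensus individual `c`, and 3 and 4 the final pair; the table is read at step number `n`. -/
def answerExpr : BExpr :=
  (inp signPosExpr).not.and (ex 1 (ex 2 (ex 3 (ex 4 ((BExpr.le (var 1) boundExpr).and
    ((qualExpr (var 2) (var 2)).and
    ((all 5 ((memTExpr (var 5)).not.or (qualExpr (var 5) (var 2)))).and
    ((dat (codeExpr sizeExpr (var 1) (var 2) (var 3) (var 4))).and
    (all 5 ((memSExpr (var 5)).not.or
      ((qualExpr (var 3) (var 5)).or (qualExpr (var 4) (var 5)))))))))))))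

/-! ### Correctness of the algorithm -/

namespace GCAIInstance

variable (I : GCAIInstance) (D ρ : ℕ → ℕ)

theorem eval_sizeExpr : sizeExpr.eval I.encode D ρ = I.n := by
  have hL := I.n_lt_length_encode
  have h : ∀ i, (BExpr.ite (ex 11 ((BExpr.le (var 11) (var 10)).and (inp (var 11)).not)) (lit 0)
      (lit 1)).eval I.encode D (Function.update ρ 10 i) = if i < I.n then 1 else 0 := by
    intro i
    have key : (ex 11 ((BExpr.le (var 11) (var 10)).and (inp (var 11)).not)).Truthy I.encode D
        (Function.update ρ 10 i) ↔ ¬ i < I.n := by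
      rw [truthy_ex]
      simp only [truthy_and, truthy_le, truthy_not, truthy_inp, eval, Function.update_self,
        Function.update_of_ne (show (10 : ℕ) ≠ 11 by decide)]
      constructor
      · rintro ⟨j, -, hj, hj'⟩ hi
        exact hj' (I.getD_encode_lt (by omega))
      · intro hi
        exact ⟨I.n, hL, by omega, by rw [getD_encode_n]; decide⟩
    rw [Truthy] at key
    simp only [BExpr.eval, key]
    split_ifs <;> rfl
  rw [sizeExpr, eval, accumulate_false, Finset.sum_congr rfl fun i _ => h i, Finset.sum_boole]
  rw [show (Finset.range I.encode.length).filter (· < I.n) = Finset.range I.n by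
    ext i; simp; omega]
  simp

theorem truthy_qualExpr {e f : BExpr} : (qualExpr e f).Truthy I.encode D ρ ↔
    I.Qualifies (e.eval I.encode D ρ) (f.eval I.encode D ρ) := by
  simp only [qualExpr, truthy_and, truthy_lt, truthy_inp, eval, eval_sizeExpr, Qualifies,
    min_eq_left I.n_lt_length_encode.le]
  constructor
  · rintro ⟨⟨he, hf⟩, h⟩
    exact ⟨he, hf, by rw [← h, ← getD_encode_φ]⟩
  · rintro ⟨he, hf, h⟩
    exact ⟨⟨he, hf⟩, by rw [← h, ← getD_encode_φ]⟩

theorem truthy_memSExpr {e : BExpr} : (memSExpr e).Truthy I.encode D ρ ↔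
    I.HasNumber I.S (e.eval I.encode D ρ) := by
  simp only [memSExpr, truthy_and, truthy_lt, truthy_inp, eval, eval_sizeExpr, HasNumber]
  rw [← exists_prop]
  exact exists_congr fun h => by simpa using congrArg (· = true) (I.getD_encode_S ⟨_, h⟩)

theorem truthy_memTExpr {e : BExpr} : (memTExpr e).Truthy I.encode D ρ ↔
    I.HasNumber I.T (e.eval I.encode D ρ) := by
  simp only [memTExpr, truthy_and, truthy_lt, truthy_inp, eval, eval_sizeExpr, HasNumber]
  rw [← exists_prop]
  exact exists_congr fun h => by simpa using congrArg (· = true) (I.getD_encode_T ⟨_, h⟩)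

theorem eval_priceExpr {e : BExpr} :
    (priceExpr e).eval I.encode D ρ = I.priceOf (e.eval I.encode D ρ) := by
  have h := I.truthy_memTExpr D ρ (e := e)
  rw [Truthy] at h
  simp only [priceExpr, eval, priceOf]
  classical exact if_congr h rfl rfl

theorem eval_signPosExpr : signPosExpr.eval I.encode D ρ = I.signPos := by
  simp only [signPosExpr, eval, eval_sizeExpr, min_eq_left I.n_lt_length_encode.le, signPos]
  ring

theorem eval_boundExpr : boundExpr.eval I.encode D ρ = I.k.natAbs := by
  simp only [boundExpr, eval, eval_signPosExpr, Function.update_self]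
  rw [accumulate_true_drop _ _ _ le_rfl, Nat.sub_self, add_zero, drop_encode, ofDigits_bits]

/-- The position of the table entry for five given indices. -/
def code (L t x c a b : ℕ) : ℕ := L * (L * (L * (L * t + x) + c) + a) + b

theorem eval_codeExpr (w : List Bool) (t x c a b : BExpr) : (codeExpr t x c a b).eval w D ρ =
    code w.length (t.eval w D ρ) (x.eval w D ρ) (c.eval w D ρ) (a.eval w D ρ) (b.eval w D ρ) := by
  simp [codeExpr, eval, code]

open Classical in
/-- The table of the truth values of `Reach`. -/
noncomputable def reachTable (m : ℕ) : ℕ :=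
  let L := I.encode.length
  if I.Reach (m / L / L / L / L) (m / L / L / L % L) (m / L / L % L) (m / L % L) (m % L)
  then 1 else 0

theorem mul_add_lt_mul {L m K i : ℕ} (hi : i < L) (hm : m < K) : L * m + i < L * K :=
  calc L * m + i < L * m + L := by omega
    _ = L * (m + 1) := by ring
    _ ≤ L * K := Nat.mul_le_mul_left _ hm

/-- The leading digit decides: entries with a smaller step number come earlier, whatever the
remaining digits of the later position. -/
theorem code_lt {L t x c a b t' x' c' a' b' : ℕ} (ht : t < t') (hx : x < L) (hc : c < L)
    (ha : a < L) (hb : b < L) : code L t x c a b < code L t' x' c' a' b' :=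
  (mul_add_lt_mul hb (lt_of_lt_of_le (mul_add_lt_mul ha (lt_of_lt_of_le (mul_add_lt_mul hc
    (lt_of_lt_of_le (mul_add_lt_mul hx ht) le_self_add)) le_self_add)) le_self_add)).trans_le
    le_self_add

-- Division and remainder recover the digits. The step number is what remains as the leading
-- quotient, so it needs no bound.
open Classical in
theorem reachTable_code {t x c a b : ℕ} (hx : x < I.encode.length) (hc : c < I.encode.length)
    (ha : a < I.encode.length) (hb : b < I.encode.length) :
    I.reachTable (code I.encode.length t x c a b) = if I.Reach t x c a b then 1 else 0 := by
  have hL : 0 < I.encode.length := by omega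
  simp only [reachTable, code, Nat.mul_add_mod, Nat.mul_add_div hL, Nat.div_eq_of_lt hx,
    Nat.div_eq_of_lt hc, Nat.div_eq_of_lt ha, Nat.div_eq_of_lt hb, Nat.mod_eq_of_lt hx,
    Nat.mod_eq_of_lt hc, Nat.mod_eq_of_lt ha, Nat.mod_eq_of_lt hb, add_zero]

variable {I D ρ}

theorem truthy_dat_codeExpr {N : ℕ} (hD : AgreeBelow I.reachTable N D) {t x c a b : BExpr}
    (hx : x.eval I.encode D ρ < I.encode.length) (hc : c.eval I.encode D ρ < I.encode.length)
    (ha : a.eval I.encode D ρ < I.encode.length) (hb : b.eval I.encode D ρ < I.encode.length)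
    (hN : code I.encode.length (t.eval I.encode D ρ) (x.eval I.encode D ρ) (c.eval I.encode D ρ)
      (a.eval I.encode D ρ) (b.eval I.encode D ρ) < N) :
    (dat (codeExpr t x c a b)).Truthy I.encode D ρ ↔ I.Reach (t.eval I.encode D ρ)
      (x.eval I.encode D ρ) (c.eval I.encode D ρ) (a.eval I.encode D ρ) (b.eval I.encode D ρ) := by
  rw [Truthy, eval, eval_codeExpr, hD _ hN, I.reachTable_code hx hc ha hb]
  simp

/-- Only entries with the preceding step number are read, and by `code_lt` they lie before the
current position. -/
theorem truthy_reachExpr (hρ : ∀ i < 5, ρ i < I.encode.length)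
    (hD : AgreeBelow I.reachTable
      (code I.encode.length (ρ 0) (ρ 1) (ρ 2) (ρ 3) (ρ 4)) D) :
    reachExpr.Truthy I.encode D ρ ↔ I.Reach (ρ 0) (ρ 1) (ρ 2) (ρ 3) (ρ 4) := by
  have hL := I.n_lt_length_encode
  have h1 := hρ 1 (by decide)
  have h2 := hρ 2 (by decide)
  have h3 := hρ 3 (by decide)
  have h4 := hρ 4 (by decide)
  by_cases h0 : ρ 0 = 0
  · have : reachExpr.Truthy I.encode D ρ ↔ ((BExpr.lt (var 2) sizeExpr).and
        ((BExpr.eq (var 3) (var 2)).and ((BExpr.eq (var 4) (var 2)).and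
        (BExpr.eq (var 1) (priceExpr (var 2)))))).Truthy I.encode D ρ := by
      simp only [reachExpr, Truthy, eval, h0, ne_eq, not_true_eq_false, if_false]
    rw [this, h0, reach_zero]
    simp only [truthy_and, truthy_lt, truthy_eq, eval, eval_sizeExpr, eval_priceExpr]
  · obtain ⟨t, ht⟩ : ∃ t, ρ 0 = t + 1 := ⟨ρ 0 - 1, by omega⟩
    have lt_code : ∀ {x c a b}, x < I.encode.length → c < I.encode.length →
        a < I.encode.length → b < I.encode.length → code I.encode.length t x c a b <
        code I.encode.length (ρ 0) (ρ 1) (ρ 2) (ρ 3) (ρ 4) :=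
      fun hx hc ha hb => code_lt (by omega) hx hc ha hb
    rw [reachExpr, Truthy, eval, if_pos (by exact h0), ← Truthy, truthy_or, truthy_or, truthy_and,
      truthy_and, truthy_and, truthy_and, truthy_ex, truthy_ex, truthy_le, truthy_le,
      truthy_qualExpr, truthy_qualExpr]
    have hd0 : (dat (codeExpr (sub (var 0) (lit 1)) (var 1) (var 2) (var 3) (var 4))).Truthy
        I.encode D ρ ↔ I.Reach t (ρ 1) (ρ 2) (ρ 3) (ρ 4) := by
      rw [truthy_dat_codeExpr hD] <;> simp [eval, ht, h1, h2, h3, h4]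
      simpa [ht] using lt_code h1 h2 h3 h4
    have hd3 : ∀ i < I.encode.length, ((dat (codeExpr (sub (var 0) (lit 1))
        (sub (var 1) (priceExpr (var 3))) (var 2) (var 5) (var 4))).Truthy I.encode D
        (Function.update ρ 5 i) ↔ I.Reach t (ρ 1 - I.priceOf (ρ 3)) (ρ 2) i (ρ 4)) := by
      intro i hi
      have hx : ρ 1 - I.priceOf (ρ 3) < I.encode.length := by omega
      rw [truthy_dat_codeExpr hD] <;> simp [eval, eval_priceExpr, ht, hi, h2, h4, hx]
      simpa [ht] using lt_code hx h2 hi h4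
    have hd4 : ∀ i < I.encode.length, ((dat (codeExpr (sub (var 0) (lit 1))
        (sub (var 1) (priceExpr (var 4))) (var 2) (var 3) (var 5))).Truthy I.encode D
        (Function.update ρ 5 i) ↔ I.Reach t (ρ 1 - I.priceOf (ρ 4)) (ρ 2) (ρ 3) i) := by
      intro i hi
      have hx : ρ 1 - I.priceOf (ρ 4) < I.encode.length := by omega
      rw [truthy_dat_codeExpr hD] <;> simp [eval, eval_priceExpr, ht, hi, h2, h3, hx]
      simpa [ht] using lt_code hx h2 h3 hi
    rw [hd0]
    simp only [truthy_and, truthy_or, truthy_qualExpr, eval_priceExpr, eval,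
      Function.update_self, Function.update_of_ne (show (3 : ℕ) ≠ 5 by decide),
      Function.update_of_ne (show (4 : ℕ) ≠ 5 by decide), ht, reach_succ]
    refine or_congr_right (or_congr ?_ ?_)
    · refine and_congr_right fun _ => and_congr_right fun _ => ?_
      constructor
      · rintro ⟨i, hi, hq, h⟩
        exact ⟨i, hq, (hd3 i hi).1 h⟩
      · rintro ⟨i, hq, h⟩
        -- `Reach` forces its arguments to be numbers of individuals, so the bounded search misses
        -- no witness.
        have hi : i < I.encode.length := h.2.1.trans hL
        exact ⟨i, hi, hq, (hd3 i hi).2 h⟩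
    · refine and_congr_right fun _ => and_congr_right fun _ => ?_
      constructor
      · rintro ⟨i, hi, hq, h⟩
        exact ⟨i, hq, (hd4 i hi).1 h⟩
      · rintro ⟨i, hq, h⟩
        have hi : i < I.encode.length := h.2.2.1.trans hL
        exact ⟨i, hi, hq, (hd4 i hi).2 h⟩

theorem exec_reachCmd : AgreeBelow I.reachTable (I.encode.length ^ 5)
    (reachCmd.exec I.encode (fun _ => 0) fun _ => 0) := by
  -- Empty prefix and five free digits.
  have h : AgreeBelow I.reachTable ((0 + 1) * I.encode.length ^ (4 + 1))
      (reachCmd.exec I.encode (fun _ => 0) fun _ => 0) := by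
    refine AgreeBelow.loop (fun t ht D hD => AgreeBelow.loop (fun x hx D hD =>
      AgreeBelow.loop (fun c hc D hD => AgreeBelow.loop (fun a ha D hD =>
      AgreeBelow.loop (k := 0) (fun b hb D hD => ?_) hD) hD) hD) hD) (fun m hm => by simp at hm)
    set ρ : ℕ → ℕ := Function.update (Function.update (Function.update (Function.update
      (Function.update (fun _ => 0) 0 t) 1 x) 2 c) 3 a) 4 b with hρ
    have h0 : ρ 0 = t := by simp [hρ]
    have h1 : ρ 1 = x := by simp [hρ]
    have h2 : ρ 2 = c := by simp [hρ]
    have h3 : ρ 3 = a := by simp [hρ]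
    have h4 : ρ 4 = b := by simp [hρ]
    rw [mul_zero, zero_add, pow_zero, mul_one] at hD ⊢
    -- The prefix built up by the five loops is by definition the Horner form of `code`.
    change AgreeBelow _ (code I.encode.length t x c a b) D at hD
    change AgreeBelow _ (code I.encode.length t x c a b + 1) _
    have key := truthy_reachExpr (I := I) (D := D) (ρ := ρ) (fun i hi => by
      interval_cases i <;> simp only [h0, h1, h2, h3, h4] <;> assumption)
      (by rwa [h0, h1, h2, h3, h4])
    rw [h0, h1, h2, h3, h4, Truthy] at key
    intro m hm
    rw [Cmd.exec, eval_codeExpr]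
    simp only [eval, h0, h1, h2, h3, h4]
    rcases Nat.lt_succ_iff_lt_or_eq.1 hm with hm | rfl
    · rw [Function.update_of_ne hm.ne, hD m hm]
    · rw [Function.update_self, I.reachTable_code hx hc ha hb]
      classical exact if_congr key rfl rfl
  simpa using h

variable (I) in
theorem truthy_answerExpr (hD : AgreeBelow I.reachTable (I.encode.length ^ 5) D) :
    answerExpr.Truthy I.encode D ρ ↔ 0 ≤ I.k ∧ ∃ (x : ℕ) (c a b : Fin I.n), (x : ℤ) ≤ I.k ∧ I.φ c c = true ∧
      (∀ t ∈ I.T, I.φ t c = true) ∧ PairReach I.φ I.T c I.n x a b ∧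
      (∀ s ∈ I.S, I.φ a s = true ∨ I.φ b s = true) ∧ x < I.encode.length := by
  have hL := I.n_lt_length_encode
  have lift : ∀ i : Fin I.n, (i : ℕ) < I.encode.length := fun i => i.2.trans hL
  have hdat : ∀ x < I.encode.length, ∀ c < I.encode.length, ∀ a < I.encode.length,
      ∀ b < I.encode.length, ∀ ρ : ℕ → ℕ, ρ 1 = x → ρ 2 = c → ρ 3 = a → ρ 4 = b →
      ((dat (codeExpr sizeExpr (var 1) (var 2) (var 3) (var 4))).Truthy I.encode D ρ ↔
        I.Reach I.n x c a b) := by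
    rintro x hx c hc a ha b hb ρ rfl rfl rfl rfl
    rw [truthy_dat_codeExpr (x := var 1) (c := var 2) (a := var 3) (b := var 4) hD hx hc ha hb,
      eval_sizeExpr]
    · rfl
    -- Step number `n` is a legitimate leading digit because `n` is below the input length.
    · rw [eval_sizeExpr, show I.encode.length ^ 5 = I.encode.length * (I.encode.length *
        (I.encode.length * (I.encode.length * I.encode.length))) by ring]
      exact mul_add_lt_mul hb (mul_add_lt_mul ha (mul_add_lt_mul hc (mul_add_lt_mul hx hL)))
  simp only [answerExpr, truthy_and, truthy_not, truthy_inp, eval_signPosExpr,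
    getD_encode_sign, decide_eq_true_eq, not_lt]
  refine and_congr_right fun hk => ?_
  have hle : ∀ x : ℕ, x ≤ I.k.natAbs ↔ (x : ℤ) ≤ I.k := fun x => by omega
  simp only [truthy_ex, truthy_and, truthy_all, truthy_or, truthy_not, truthy_le, truthy_qualExpr,
    truthy_memTExpr, truthy_memSExpr, eval_boundExpr, eval, Function.update_self, ne_eq,
    Nat.reduceEqDiff, OfNat.one_ne_ofNat, not_false_eq_true, Function.update_of_ne, hle]
  constructor
  · rintro ⟨x, hx, c, hc, a, ha, b, hb, hxk, hcc, hT, hr, hS⟩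
    rw [hdat x hx c hc a ha b hb _ (by simp) (by simp) (by simp) (by simp)] at hr
    obtain ⟨hc', ha', hb', hr⟩ := hr
    refine ⟨x, ⟨c, hc'⟩, ⟨a, ha'⟩, ⟨b, hb'⟩, hxk, hcc.2.2, fun t ht => ?_, hr, fun s hs => ?_, hx⟩
    · exact ((hT t (lift t)).resolve_left fun h => h ⟨t.2, ht⟩).2.2
    · exact ((hS s (lift s)).resolve_left fun h => h ⟨s.2, hs⟩).imp (fun h => h.2.2)
        fun h => h.2.2
  · rintro ⟨x, c, a, b, hxk, hcc, hT, hr, hS, hx⟩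
    refine ⟨x, hx, c, lift c, a, lift a, b, lift b, hxk, ⟨c.2, c.2, hcc⟩, fun t _ => ?_, ?_,
      fun s _ => ?_⟩
    · by_cases ht : I.HasNumber I.T t
      · exact Or.inr ⟨ht.1, c.2, hT _ ht.2⟩
      · exact Or.inl ht
    · rw [hdat x hx c (lift c) a (lift a) b (lift b) _ (by simp) (by simp) (by simp) (by simp)]
      exact ⟨c.2, a.2, b.2, hr⟩
    · by_cases hs : I.HasNumber I.S s
      · exact Or.inr ((hS _ hs.2).imp (fun h => ⟨a.2, hs.1, h⟩) fun h => ⟨b.2, hs.1, h⟩)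
      · exact Or.inl hs

/-- Only the forward direction uses QC. There the price is at most `|U| ≤ n`, hence below the input
length, so restricting the search to such prices loses nothing. -/
theorem isYesCSR_iff (hQC : IsQC I.φ) :
    I.IsYesCSR ↔ 0 ≤ I.k ∧ ∃ (x : ℕ) (c a b : Fin I.n), (x : ℤ) ≤ I.k ∧ I.φ c c = true ∧
      (∀ t ∈ I.T, I.φ t c = true) ∧ PairReach I.φ I.T c I.n x a b ∧
      (∀ s ∈ I.S, I.φ a s = true ∨ I.φ b s = true) ∧ x < I.encode.length := by
  constructor
  · rintro ⟨U, -, hUk, hU⟩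
    obtain ⟨c, x, a, b, hx, hcc, hT, hr, hS⟩ := hQC.exists_pairReach I.S_nonempty hU
    rw [Fintype.card_fin] at hr
    have hUn : U.card ≤ I.n := by simpa using Finset.card_le_univ U
    exact ⟨by omega, x, c, a, b, by omega, hcc, hT, hr, hS,
      (hx.trans hUn).trans_lt I.n_lt_length_encode⟩
  · rintro ⟨-, x, c, a, b, hxk, hcc, hT, hr, hS, -⟩
    obtain ⟨U, hUT, hUx, hU⟩ := exists_control_of_pairReach I.S_subset_T hcc hT hr hS
    exact ⟨U, hUT, by omega, hU⟩

end GCAIInstance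

end GroupIdent

theorem mainTheorem5 :
    RAM.PolyTimeSolvableOn GroupIdent.GCAIInstance.encode
      (fun I : GroupIdent.GCAIInstance => GroupIdent.IsQC I.φ)
      (fun I : GroupIdent.GCAIInstance => I.IsYesCSR) :=
  RAM.polyTimeSolvableOn_of_cmd GroupIdent.reachCmd GroupIdent.answerExpr fun I hI =>
    (I.truthy_answerExpr GroupIdent.GCAIInstance.exec_reachCmd).trans
      (GroupIdent.GCAIInstance.isYesCSR_iff hI).symm
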